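/- Let $M$ be a commutative von Neumann algebra on a complex Hilbert space $H$, with a faithful normal finite trace $\tau$, and let $P(M)$ be its lattice of projections. Let $S(M,\tau)$ be the *-algebra of $\tau$-measurable operators: closed operators $x$ affiliated with $M$ such that for every $\varepsilon>0$ there is $p\in P(M)$ with $p(H)\subset\mathcal D(x)$ and $\tau(p^\perp)<\varepsilon$, with strong addition and strong multiplication (closures of the sum and of the product). A Young function is a function $\phi(t)=\int_0^t g(s)\,ds$, $t\ge 0$, where $g:[0,\infty)\to\mathbb R$ is right continuous and nondecreasing on $(0,\infty)$, $g(0)=0$, $g(s)>0$ for $s>0$, and $g(s)\to\infty$ as $s\to\infty$. Write $\phi_1\prec\phi_2$ if there are $c,T\ge 0$ with $\phi_1(t)\le\phi_2(ct)$ for all $t\ge T$. Let $\Lambda$ be a nonempty quadratic generating family of Young functions, i.e. for all $\phi_1,\phi_2\in\Lambda$ there is $\psi\in\Lambda$ with $\phi_1,\phi_2\prec\psi$, and for every $\phi\in\Lambda$ there are $\psi\in\Lambda$, $c>0$, $T\ge 0$ with $\phi(t^2)\le\psi(ct)$ for all $t\ge T$. Put $K_\phi=\{x\in S(M,\tau):\tau(\phi(|x|))\le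 1\}$, $L_\phi(M,\tau)=\bigcup_{n\ge 1}nK_\phi$ and $L^\Lambda(M,\tau)=\bigcap_{\phi\in\Lambda}L_\phi(M,\tau)$; this is a subalgebra of $S(M,\tau)$. Let $\delta:L^\Lambda(M,\tau)\to L^\Lambda(M,\tau)$ be an additive derivation, i.e. $\delta(x+y)=\delta(x)+\delta(y)$ and $\delta(xy)=\delta(x)y+x\delta(y)$ for all $x,y$, and let $z_\delta=\inf\{z\in P(M): z\delta=\delta\}$ be its support. Then $z_\delta$ exists in $P(M)$ and the algebra $z_\delta M$ is finite-dimensional. Consequently $\delta$ is nonzero only on finitely many atoms: there are finitely many mutually orthogonal atoms $q_1,\dots,q_k$ of $P(M)$ (possibly $k=0$) and nonzero additive derivations $\delta_1,\dots,\delta_k:\mathbb C\to\mathbb C$ such that $z_\delta=q_1+\dots+q_k$ and, for every $x\in L^\Lambda(M,\tau)$, there are $\lambda_1,\dots,\lambda_k\in\mathbb C$ with $q_ix=\lambda_iq_i$ for all $i$ and $\delta(x)=\sum_{i=1}^k\delta_i(\lambda_i)q_i$. -/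

import Mathlib

noncomputable section

namespace GenArens

open MeasureTheory
open scoped NNReal ENNReal ComplexOrder

variable {H : Type*} [NormedAddCommGroup H] [InnerProductSpace ℂ H] [CompleteSpace H]

/-! ### Projections and traces -/

/-- The lattice `P(M)` of (self-adjoint) projections of `M`, with the order of operators. -/
abbrev Proj (M : VonNeumannAlgebra H) : Type _ :=
  {p : M.toStarSubalgebra // IsStarProjection p}

/-- A projection of `M`, as a bounded operator on `H`. -/
def Proj.op {M : VonNeumannAlgebra H} (p : Proj M) : H →L[ℂ] H := (p.1 : H →L[ℂ] H)

/-- `q` is an atom (a minimal nonzero element) of `P(M)`. -/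
def Proj.IsMinimal {M : VonNeumannAlgebra H} (q : Proj M) : Prop :=
  q.op ≠ 0 ∧ ∀ p : Proj M, p ≤ q → p.op = 0 ∨ p = q

/-- A faithful normal finite trace on `M`: a positive linear functional `τ : M → ℂ` with
`τ (a b) = τ (b a)`, which is faithful and preserves the suprema of increasing nets of positive
elements. -/
structure FiniteTrace (M : VonNeumannAlgebra H) where
  toLinearMap : M.toStarSubalgebra →ₗ[ℂ] ℂ
  nonneg : ∀ a : M.toStarSubalgebra, 0 ≤ a → 0 ≤ (toLinearMap a).re ∧ (toLinearMap a).im = 0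
  tracial : ∀ a b : M.toStarSubalgebra, toLinearMap (a * b) = toLinearMap (b * a)
  faithful : ∀ a : M.toStarSubalgebra, 0 ≤ a → toLinearMap a = 0 → a = 0
  normal : ∀ (D : Set M.toStarSubalgebra) (s : M.toStarSubalgebra), D.Nonempty →
    DirectedOn (· ≤ ·) D → (∀ a ∈ D, 0 ≤ a) → IsLUB D s →
    IsLUB ((fun a => (toLinearMap a).re) '' D) (toLinearMap s).re

/-- The (real) value of the trace. -/
def FiniteTrace.val {M : VonNeumannAlgebra H} (τ : FiniteTrace M) (a : M.toStarSubalgebra) : ℝ :=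
  (τ.toLinearMap a).re

/-! ### Unbounded operators and measurable operators -/

/-- A bounded operator as an everywhere defined operator. -/
def ofCLM (a : H →L[ℂ] H) : H →ₗ.[ℂ] H := (a : H →ₗ[ℂ] H).toPMap ⊤

/-- The natural domain `{ξ ∈ 𝒟(y) | y ξ ∈ 𝒟(x)}` of the product of two unbounded operators. -/
def mulDomain (x y : H →ₗ.[ℂ] H) : Submodule ℂ H :=
  (x.domain.comap y.toFun).map y.domain.subtype

/-- The product `ξ ↦ x (y ξ)` of two unbounded operators, on its natural domain. -/
def opMul (x y : H →ₗ.[ℂ] H) : H →ₗ.[ℂ] H :=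
  x.comp (y.domRestrict (mulDomain x y)) (by
    rintro ⟨ξ, hξ⟩
    obtain ⟨η, hη, rfl⟩ := hξ.1
    exact hη)

/-- Strong addition: the closure of the sum (defined on `𝒟(x) ∩ 𝒟(y)`). -/
def strongAdd (x y : H →ₗ.[ℂ] H) : H →ₗ.[ℂ] H := (x + y).closure

/-- Strong multiplication: the closure of the product. -/
def strongMul (x y : H →ₗ.[ℂ] H) : H →ₗ.[ℂ] H := (opMul x y).closure

/-- `x` is affiliated with `M`: for every unitary `u` of the commutant, `u 𝒟(x) ⊆ 𝒟(x)` and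
`u (x ξ) = x (u ξ)` on `𝒟(x)`. -/
def Affiliated (M : VonNeumannAlgebra H) (x : H →ₗ.[ℂ] H) : Prop :=
  ∀ u ∈ M.commutant, u ∈ unitary (H →L[ℂ] H) →
    ∀ ξ : x.domain, ∃ h : u (ξ : H) ∈ x.domain, u (x ξ) = x ⟨u (ξ : H), h⟩

/-- `S(M, τ)`: the closed operators affiliated with `M` whose domain is `τ`-dense. -/
def measurableOps {M : VonNeumannAlgebra H} (τ : FiniteTrace M) : Set (H →ₗ.[ℂ] H) :=
  {x | x.IsClosed ∧ Affiliated M x ∧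
    ∀ ε : ℝ, 0 < ε → ∃ p : Proj M, (∀ ξ : H, p.op ξ ∈ x.domain) ∧ τ.val (1 - p.1) < ε}

/-! ### Spectral measures -/

/-- A projection-valued measure on `[0, ∞)` with values in `P(M)`
(only its values on Borel sets matter). -/
structure PVM (M : VonNeumannAlgebra H) where
  proj : Set ℝ≥0 → M.toStarSubalgebra
  isStarProjection : ∀ B, MeasurableSet B → IsStarProjection (proj B)
  univ : proj Set.univ = 1
  hasSum : ∀ B : ℕ → Set ℝ≥0, (∀ n, MeasurableSet (B n)) →
    Pairwise (Function.onFun Disjoint B) → ∀ ξ : H,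
    HasSum (fun n => (proj (B n) : H →L[ℂ] H) ξ) ((proj (⋃ n, B n) : H →L[ℂ] H) ξ)

variable {M : VonNeumannAlgebra H}

theorem PVM.proj_empty (E : PVM M) : E.proj ∅ = 0 := by
  apply Subtype.ext
  ext ξ
  have h := E.hasSum (fun _ => ∅) (fun _ => MeasurableSet.empty)
    (fun _ _ _ => disjoint_bot_left) ξ
  have h2 := h.summable.tendsto_atTop_zero
  have h3 := tendsto_nhds_unique h2 tendsto_const_nhds
  simpa using h3.symm

theorem inner_nonneg_of_isStarProjection {a : M.toStarSubalgebra} (ha : IsStarProjection a)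
    (ξ : H) : 0 ≤ (inner ℂ ξ ((a : H →L[ℂ] H) ξ)).re := by
  have h1 : (a : H →L[ℂ] H) * (a : H →L[ℂ] H) = a := congrArg Subtype.val ha.isIdempotentElem.eq
  have h2 : star (a : H →L[ℂ] H) = a := congrArg Subtype.val ha.isSelfAdjoint.star_eq
  have h3 : inner ℂ ξ ((a : H →L[ℂ] H) ξ)
      = inner ℂ ((a : H →L[ℂ] H) ξ) ((a : H →L[ℂ] H) ξ) := by
    conv_lhs => rw [← h1]
    rw [mul_apply_eq_comp]
    conv_rhs => rw [← ContinuousLinearMap.adjoint_inner_right]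
    rw [← ContinuousLinearMap.star_eq_adjoint, h2]
  rw [h3]
  exact inner_self_nonneg (𝕜 := ℂ)

theorem nonneg_of_isStarProjection {a : M.toStarSubalgebra} (ha : IsStarProjection a) :
    0 ≤ a := by
  change (0 : H →L[ℂ] H) ≤ (a : H →L[ℂ] H)
  have h1 : (a : H →L[ℂ] H) * (a : H →L[ℂ] H) = a := congrArg Subtype.val ha.isIdempotentElem.eq
  have h2 : star (a : H →L[ℂ] H) = a := congrArg Subtype.val ha.isSelfAdjoint.star_eq
  have h3 := star_mul_self_nonneg (a : H →L[ℂ] H)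
  rwa [h2, h1] at h3

/-- The scalar spectral measure `B ↦ ⟨ξ, E(B) ξ⟩`. -/
def PVM.scalarMeasure (E : PVM M) (ξ : H) : Measure ℝ≥0 :=
  Measure.ofMeasurable
    (fun B _ => ENNReal.ofReal (inner ℂ ξ ((E.proj B : H →L[ℂ] H) ξ)).re)
    (by simp [E.proj_empty])
    (by
      intro B hB hd
      have h1 := (E.hasSum B hB hd ξ).mapL (innerSL ℂ ξ)
      have h2 := h1.mapL Complex.reCLM
      have h3 : HasSum (fun n => (inner ℂ ξ ((E.proj (B n) : H →L[ℂ] H) ξ)).re)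
        (inner ℂ ξ ((E.proj (⋃ n, B n) : H →L[ℂ] H) ξ)).re := h2
      rw [← h3.tsum_eq]
      exact ENNReal.ofReal_tsum_of_nonneg
        (fun n => inner_nonneg_of_isStarProjection (E.isStarProjection _ (hB n)) ξ) h3.summable)

theorem le_of_inner {a b : M.toStarSubalgebra}
    (h : ∀ ξ : H, inner ℂ ((a : H →L[ℂ] H) ξ) ξ ≤ (inner ℂ ((b : H →L[ℂ] H) ξ) ξ : ℂ)) :
    a ≤ b := by
  change (a : H →L[ℂ] H) ≤ (b : H →L[ℂ] H)
  rw [ContinuousLinearMap.le_def, ContinuousLinearMap.isPositive_iff_complex]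
  intro ξ
  have h1 : 0 ≤ inner ℂ (((b : H →L[ℂ] H) - (a : H →L[ℂ] H)) ξ) ξ := by
    rw [sub_apply, inner_sub_left]
    exact sub_nonneg.2 (h ξ)
  rw [Complex.nonneg_iff] at h1
  refine ⟨?_, h1.1⟩
  apply Complex.ext
  · rfl
  · simpa [inner_sub_left] using h1.2

theorem inner_le_of_le {a b : M.toStarSubalgebra} (h : a ≤ b) (ξ : H) :
    inner ℂ ((a : H →L[ℂ] H) ξ) ξ ≤ (inner ℂ ((b : H →L[ℂ] H) ξ) ξ : ℂ) := by
  have h0 : (a : H →L[ℂ] H) ≤ (b : H →L[ℂ] H) := h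
  rw [ContinuousLinearMap.le_def] at h0
  have h1 := h0.inner_nonneg_left ξ
  rw [sub_apply, inner_sub_left] at h1
  exact sub_nonneg.1 h1

/-- Countable additivity of `τ ∘ E`, from normality of `τ`. -/
theorem FiniteTrace.hasSum_proj (τ : FiniteTrace M) (E : PVM M) (B : ℕ → Set ℝ≥0)
    (hB : ∀ n, MeasurableSet (B n)) (hd : Pairwise (Function.onFun Disjoint B)) :
    HasSum (fun n => τ.val (E.proj (B n))) (τ.val (E.proj (⋃ n, B n))) := by
  have hpos : ∀ n, 0 ≤ E.proj (B n) := fun n =>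
    nonneg_of_isStarProjection (E.isStarProjection _ (hB n))
  have happ : ∀ (F : Finset ℕ) (ξ : H), ((∑ n ∈ F, E.proj (B n) : M.toStarSubalgebra) :
      H →L[ℂ] H) ξ = ∑ n ∈ F, (E.proj (B n) : H →L[ℂ] H) ξ := by
    intro F ξ
    have : ((∑ n ∈ F, E.proj (B n) : M.toStarSubalgebra) : H →L[ℂ] H)
        = ∑ n ∈ F, (E.proj (B n) : H →L[ℂ] H) := by
      exact map_sum M.toStarSubalgebra.subtype _ _
    rw [this]
    simp
  have hmono : Monotone (fun F : Finset ℕ => ∑ n ∈ F, E.proj (B n)) :=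
    fun F G hFG => le_of_inner fun ξ => by
      simp only [happ, sum_inner]
      refine Finset.sum_le_sum_of_subset_of_nonneg hFG fun n _ _ => ?_
      simpa using inner_le_of_le (hpos n) ξ
  have hlub : IsLUB (Set.range (fun F : Finset ℕ => ∑ n ∈ F, E.proj (B n)))
      (E.proj (⋃ n, B n)) := by
    have hlim : ∀ ξ : H, Filter.Tendsto (fun F : Finset ℕ => inner ℂ
        (((∑ n ∈ F, E.proj (B n) : M.toStarSubalgebra) : H →L[ℂ] H) ξ) ξ) Filter.atTop
        (nhds (inner ℂ ((E.proj (⋃ n, B n) : H →L[ℂ] H) ξ) ξ : ℂ)) := by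
      intro ξ
      have h1 : Filter.Tendsto (fun F : Finset ℕ => ∑ n ∈ F, (E.proj (B n) : H →L[ℂ] H) ξ)
        Filter.atTop (nhds ((E.proj (⋃ n, B n) : H →L[ℂ] H) ξ)) := by
        simpa [HasSum] using E.hasSum B hB hd ξ
      simp only [happ]
      exact h1.inner tendsto_const_nhds
    constructor
    · rintro _ ⟨F, rfl⟩
      refine le_of_inner fun ξ => ?_
      have hm : Monotone (fun F : Finset ℕ => (inner ℂ
        (((∑ n ∈ F, E.proj (B n) : M.toStarSubalgebra) : H →L[ℂ] H) ξ) ξ : ℂ)) :=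
        fun F G hFG => inner_le_of_le (hmono hFG) ξ
      exact hm.ge_of_tendsto (hlim ξ) F
    · intro b hb
      refine le_of_inner fun ξ => ?_
      exact le_of_tendsto' (hlim ξ) fun F => inner_le_of_le (hb ⟨F, rfl⟩) ξ
  have hn := τ.normal _ _ (Set.range_nonempty _) (directedOn_range.2 hmono.directed_le)
    (by rintro _ ⟨F, rfl⟩; simpa using hmono (Finset.empty_subset F)) hlub
  rw [← Set.range_comp] at hn
  have hval : ∀ F : Finset ℕ,
      τ.val (∑ n ∈ F, E.proj (B n)) = ∑ n ∈ F, τ.val (E.proj (B n)) := by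
    intro F; simp [FiniteTrace.val, map_sum]
  have hm2 : Monotone (fun F : Finset ℕ => τ.val (∑ n ∈ F, E.proj (B n))) := by
    intro F G hFG
    simp only [hval]
    exact Finset.sum_le_sum_of_subset_of_nonneg hFG fun n _ _ => (τ.nonneg _ (hpos n)).1
  have h3 := tendsto_atTop_isLUB hm2 hn
  simp only [hval] at h3
  simpa [HasSum] using (show Filter.Tendsto _ _ (nhds (τ.val _)) from h3)

/-- The measure `τ ∘ E` on `[0, ∞)`. -/
def FiniteTrace.spectralDistribution (τ : FiniteTrace M) (E : PVM M) : Measure ℝ≥0 :=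
  Measure.ofMeasurable (fun B _ => ENNReal.ofReal (τ.val (E.proj B)))
    (by simp [E.proj_empty, FiniteTrace.val])
    (by
      intro B hB hd
      have h3 := τ.hasSum_proj E B hB hd
      rw [← h3.tsum_eq]
      exact ENNReal.ofReal_tsum_of_nonneg
        (fun n => (τ.nonneg _ (nonneg_of_isStarProjection (E.isStarProjection _ (hB n)))).1)
        h3.summable)

/-- `E` is the spectral measure of the modulus `|x| = (x* x)^(1/2)` of the closed densely defined
operator `x`. The modulus is the positive self-adjoint operator with `𝒟(|x|) = 𝒟(x)` and
`‖|x| ξ‖ = ‖x ξ‖`, and `∫ t dE(t)` is the positive self-adjoint operator with domain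
`{ξ | ∫ t² d⟨ξ, E(t) ξ⟩ < ∞}` and `‖(∫ t dE(t)) ξ‖² = ∫ t² d⟨ξ, E(t) ξ⟩`; both are determined by
these domains and norms. -/
def IsModulusSpectralMeasure (x : H →ₗ.[ℂ] H) (E : PVM M) : Prop :=
  (∀ ξ : H, ξ ∈ x.domain ↔ ∫⁻ t, (t : ℝ≥0∞) ^ 2 ∂(E.scalarMeasure ξ) < ∞) ∧
  ∀ ξ : x.domain, ENNReal.ofReal (‖x ξ‖ ^ 2) = ∫⁻ t, (t : ℝ≥0∞) ^ 2 ∂(E.scalarMeasure (ξ : H))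

/-! ### Young functions and generalized Arens algebras -/

/-- `φ(t) = ∫₀ᵗ g(s) ds` for `t ≥ 0`, where `g(0) = 0`, `g > 0` on `(0, ∞)`, `g(s) → ∞`, and `g`
is right continuous and nondecreasing (values at negative arguments are irrelevant). -/
def IsYoung (φ : ℝ → ℝ) : Prop :=
  ∃ g : ℝ → ℝ, g 0 = 0 ∧ (∀ s, 0 < s → 0 < g s) ∧ Filter.Tendsto g Filter.atTop Filter.atTop ∧
    (∀ s, 0 ≤ s → ContinuousWithinAt g (Set.Ici s) s) ∧ MonotoneOn g (Set.Ioi 0) ∧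
    ∀ t, 0 ≤ t → φ t = ∫ s in (0 : ℝ)..t, g s

/-- `φ₁ ≺ φ₂`. -/
def YoungLE (φ₁ φ₂ : ℝ → ℝ) : Prop :=
  ∃ c T : ℝ, 0 ≤ c ∧ 0 ≤ T ∧ ∀ t, T ≤ t → φ₁ t ≤ φ₂ (c * t)

/-- A quadratic (generating) family of Young functions. -/
structure IsQuadraticFamily (Λ : Set (ℝ → ℝ)) : Prop where
  nonempty : Λ.Nonempty
  young : ∀ φ ∈ Λ, IsYoung φ
  generating : ∀ φ₁ ∈ Λ, ∀ φ₂ ∈ Λ, ∃ ψ ∈ Λ, YoungLE φ₁ ψ ∧ YoungLE φ₂ ψ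
  quadratic : ∀ φ ∈ Λ, ∃ ψ ∈ Λ, ∃ c T : ℝ, 0 < c ∧ 0 ≤ T ∧ ∀ t, T ≤ t → φ (t ^ 2) ≤ ψ (c * t)

/-- `K_φ = {x ∈ S(M, τ) | τ(φ(|x|)) ≤ 1}`, where `τ(φ(|x|)) = ∫ φ(t) dτ(E(t))` for the spectral
measure `E` of `|x|`. -/
def orliczUnitBall (τ : FiniteTrace M) (φ : ℝ → ℝ) : Set (H →ₗ.[ℂ] H) :=
  {x | x ∈ measurableOps τ ∧ ∃ E : PVM M, IsModulusSpectralMeasure x E ∧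
    ∫⁻ t, ENNReal.ofReal (φ t) ∂(τ.spectralDistribution E) ≤ 1}

/-- `L_φ(M, τ) = ⋃ n ≥ 1, n K_φ`. -/
def orliczSpace (τ : FiniteTrace M) (φ : ℝ → ℝ) : Set (H →ₗ.[ℂ] H) :=
  {x | ∃ n : ℕ, 1 ≤ n ∧ ∃ y ∈ orliczUnitBall τ φ, x = (n : ℂ) • y}

/-- `L^Λ(M, τ) = ⋂ φ ∈ Λ, L_φ(M, τ)`. -/
def arensAlgebra (τ : FiniteTrace M) (Λ : Set (ℝ → ℝ)) : Set (H →ₗ.[ℂ] H) :=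
  {x | x ∈ measurableOps τ ∧ ∀ φ ∈ Λ, x ∈ orliczSpace τ φ}

/-! ### Additive derivations and their supports -/

/-- `δ` is an additive derivation of `L^Λ(M, τ)` with the strong operations:
`δ(x + y) = δ(x) + δ(y)` and `δ(x y) = δ(x) y + x δ(y)`. -/
structure IsAdditiveDerivation {τ : FiniteTrace M} {Λ : Set (ℝ → ℝ)}
    (δ : arensAlgebra τ Λ → arensAlgebra τ Λ) : Prop where
  map_add : ∀ x y z : arensAlgebra τ Λ, z.1 = strongAdd x.1 y.1 →
    (δ z).1 = strongAdd (δ x).1 (δ y).1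
  leibniz : ∀ x y z : arensAlgebra τ Λ, z.1 = strongMul x.1 y.1 →
    (δ z).1 = strongAdd (strongMul (δ x).1 y.1) (strongMul x.1 (δ y).1)

/-- The set `{z ∈ P(M) | z δ = δ}`, whose infimum in `P(M)` is the support of `δ`. -/
def supportSet {τ : FiniteTrace M} {Λ : Set (ℝ → ℝ)}
    (δ : arensAlgebra τ Λ → arensAlgebra τ Λ) : Set (Proj M) :=
  {z | ∀ x, strongMul (ofCLM z.op) (δ x).1 = (δ x).1}

/-- The algebra `z M = {z a | a ∈ M}`, as a linear subspace of the bounded operators. -/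
def cutDown (z : Proj M) : Submodule ℂ (H →L[ℂ] H) :=
  M.toStarSubalgebra.toSubalgebra.toSubmodule.map (LinearMap.mulLeft ℂ z.op)

end GenArens

end

set_option linter.unusedSectionVars false

noncomputable section

namespace GenArens

open MeasureTheory
open scoped NNReal ENNReal ComplexOrder

variable {H : Type*} [NormedAddCommGroup H] [InnerProductSpace ℂ H] [CompleteSpace H]
variable {M : VonNeumannAlgebra H}

/-! ### Projections representing quadratic forms -/

/-! A derivation of a commutative algebra kills idempotents: `δ(p) = 2pδ(p)` forces `pδ(p) = 0`,
hence `δ(p) = 0`. Likewise `(ip)² = -p` gives `δ(ip) = 0`, so `δ` vanishes on all Gaussian integer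
combinations of projections (`bddDer_gaussian`). By the spectral theorem every `a ∈ M` lies within
norm 2 of such a combination, whatever the size of `a` (`exists_approx`). So if `|δ(b)| ≥ ε` on a
projection `r` (an "active" projection), subtracting from `nb` an approximating combination leaves
an element of norm at most 2 whose derivative is at least `nε` on `r` (`exists_bounded_large`).

Suppose there were infinitely many orthogonal active projections `r_n`. Elements `x_n` of norm at
most 2 with `δ(x_n)` enormous on `r_n` glue to one `a ∈ M` (`exists_glue`), and `δ(a)` agrees with
`δ(x_n)` on `r_n` (`cut_bddDer_congr`). Such a `δ(a)` is too large to lie in `L_φ`, for any one `φ ∈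
Λ`; this is `not_exists_orthogonal_active`. Hence every active projection dominates an active atom,
there are finitely many active atoms, and `δ` vanishes off their sum `z`. On an atom `qM = ℂq`, so
there `δ` is an additive derivation of `ℂ`.

Unbounded operators are handled through `Cut T e b`, meaning `Te = b` with `b` bounded. Sums and
products are computed on cuts, and a closed affiliated operator is recovered from cuts along
projections tending strongly to 1 (`eq_of_cut`). The cuts come from the spectral measures in the
definition of `L_φ`. Spectral measures of bounded operators are built from Riesz measures, each
projection being identified by its quadratic form. -/

theorem inner_apply_self_of_isStarProjection {P : H →L[ℂ] H} (hP : IsStarProjection P) (ξ : H) :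
    inner ℂ (P ξ) ξ = ((‖P ξ‖ ^ 2 : ℝ) : ℂ) := by
  have h1 : P (P ξ) = P ξ := congrArg (fun T : H →L[ℂ] H => T ξ) hP.isIdempotentElem.eq
  have h2 : ContinuousLinearMap.adjoint P = P := hP.isSelfAdjoint.star_eq
  have h3 : inner ℂ (P ξ) (P ξ) = (inner ℂ (P (P ξ)) ξ : ℂ) := by
    rw [← ContinuousLinearMap.adjoint_inner_left, h2]
  rw [h1] at h3
  rw [← h3, inner_self_eq_norm_sq_to_K]
  simp

theorem clm_ext_inner {S T : H →L[ℂ] H} (h : ∀ ξ, inner ℂ (S ξ) ξ = (inner ℂ (T ξ) ξ : ℂ)) :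
    S = T := by
  have := (ext_inner_map (S : H →ₗ[ℂ] H) (T : H →ₗ[ℂ] H)).1 h
  ext ξ
  exact congrArg (fun f : H →ₗ[ℂ] H => f ξ) this

/-- `P* P` and `P` have the same quadratic form, so they coincide by polarization; then `P` is
self-adjoint and therefore idempotent. -/
theorem isStarProjection_of_norm_sq {P : H →L[ℂ] H}
    (h : ∀ ξ, inner ℂ (P ξ) ξ = ((‖P ξ‖ ^ 2 : ℝ) : ℂ)) : IsStarProjection P := by
  have h1 : star P * P = P := by
    apply clm_ext_inner
    intro ξ
    rw [h, mul_apply_eq_comp, ContinuousLinearMap.star_eq_adjoint,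
      ContinuousLinearMap.adjoint_inner_left, inner_self_eq_norm_sq_to_K]
    simp
  have h2 : star P = P := by
    conv_lhs => rw [← h1]
    rw [star_mul, star_star, h1]
  refine ⟨?_, h2⟩
  rw [h2] at h1
  exact h1

theorem isStarProjection_ext {P Q : H →L[ℂ] H} (hP : IsStarProjection P)
    (hQ : IsStarProjection Q) (h : ∀ ξ, ‖P ξ‖ ^ 2 = ‖Q ξ‖ ^ 2) : P = Q := by
  apply clm_ext_inner
  intro ξ
  rw [inner_apply_self_of_isStarProjection hP, inner_apply_self_of_isStarProjection hQ, h]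

/-- There is a projection commuting with `S` whose quadratic form is `r`. -/
def HasProj (S : Set (H →L[ℂ] H)) (r : H → ℝ) : Prop :=
  ∃ P : H →L[ℂ] H, IsStarProjection P ∧ (∀ u ∈ S, Commute u P) ∧ ∀ ξ, ‖P ξ‖ ^ 2 = r ξ

theorem cauchySeq_of_norm_sub_sq_le {v : ℕ → H} {s : ℕ → ℝ} (hs : CauchySeq s)
    (h : ∀ n m, ‖v n - v m‖ ^ 2 ≤ |s n - s m|) : CauchySeq v := by
  rw [Metric.cauchySeq_iff]
  intro ε hε
  obtain ⟨N, hN⟩ := Metric.cauchySeq_iff.1 hs (ε ^ 2) (by positivity)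
  refine ⟨N, fun m hm n hn => ?_⟩
  have := hN m hm n hn
  rw [Real.dist_eq] at this
  rw [dist_eq_norm]
  exact lt_of_pow_lt_pow_left₀ 2 hε.le ((h m n).trans_lt this)

/-- The scalar Cauchy sequences dominate, so `T n` converges strongly. Its limit `P` satisfies `⟨Pξ,
ξ⟩ = ‖Pξ‖²` because both limits equal `r ξ`, and commutation survives strong limits. -/
theorem hasProj_of_tendsto {S : Set (H →L[ℂ] H)} {r : H → ℝ} (T : ℕ → H →L[ℂ] H)
    (hS : ∀ n, ∀ u ∈ S, Commute u (T n)) (s : ℕ → H → ℝ) (hs : ∀ ξ, CauchySeq fun n => s n ξ)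
    (hT : ∀ n m ξ, ‖T n ξ - T m ξ‖ ^ 2 ≤ |s n ξ - s m ξ|)
    (h1 : ∀ ξ, Filter.Tendsto (fun n => (inner ℂ (T n ξ) ξ : ℂ)) Filter.atTop (nhds (r ξ : ℂ)))
    (h2 : ∀ ξ, Filter.Tendsto (fun n => ‖T n ξ‖ ^ 2) Filter.atTop (nhds (r ξ))) :
    HasProj S r := by
  have hc : ∀ ξ, CauchySeq fun n => T n ξ := fun ξ =>
    cauchySeq_of_norm_sub_sq_le (hs ξ) fun n m => hT n m ξ
  choose f hf using fun ξ => cauchySeq_tendsto_of_complete (hc ξ)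
  let P : H →L[ℂ] H := continuousLinearMapOfTendsto T (f := f) (tendsto_pi_nhds.2 hf)
  have hP : ∀ ξ, Filter.Tendsto (fun n => T n ξ) Filter.atTop (nhds (P ξ)) := hf
  have h3 : ∀ ξ, ‖P ξ‖ ^ 2 = r ξ := fun ξ =>
    tendsto_nhds_unique (((hP ξ).norm).pow 2) (h2 ξ)
  have h4 : ∀ ξ, inner ℂ (P ξ) ξ = ((r ξ : ℝ) : ℂ) := fun ξ =>
    tendsto_nhds_unique ((hP ξ).inner tendsto_const_nhds) (h1 ξ)
  refine ⟨P, isStarProjection_of_norm_sq fun ξ => by rw [h4, h3], fun u hu => ?_, h3⟩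
  ext ξ
  have h5 : Filter.Tendsto (fun n => u (T n ξ)) Filter.atTop (nhds (u (P ξ))) :=
    (u.continuous.tendsto _).comp (hP ξ)
  have h6 : (fun n => u (T n ξ)) = fun n => T n (u ξ) := by
    ext n
    exact congrArg (fun A : H →L[ℂ] H => A ξ) (hS n u hu).eq
  rw [h6] at h5
  exact tendsto_nhds_unique h5 (hP (u ξ))

theorem HasProj.one_sub {S : Set (H →L[ℂ] H)} {r : H → ℝ} (h : HasProj S r) :
    HasProj S fun ξ => ‖ξ‖ ^ 2 - r ξ := by
  obtain ⟨P, hP, hc, hr⟩ := h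
  refine ⟨1 - P, hP.one_sub, fun u hu => (Commute.one_right u).sub_right (hc u hu), fun ξ => ?_⟩
  have h1 := inner_apply_self_of_isStarProjection hP.one_sub ξ
  rw [sub_apply, inner_sub_left, inner_apply_self_of_isStarProjection hP, hr] at h1
  rw [one_apply_eq_self, inner_self_eq_norm_sq_to_K] at h1
  have : (((‖ξ‖ ^ 2 - r ξ : ℝ)) : ℂ) = ((‖(1 - P) ξ‖ ^ 2 : ℝ) : ℂ) := by
    rw [sub_apply, one_apply_eq_self, ← h1]; push_cast; rfl
  exact_mod_cast this.symm

/-- On a vector fixed by `Q` the term `‖Qξ‖²` already exhausts `‖ξ‖²`. -/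
theorem mul_eq_zero_of_norm_sq_add_le {P Q : H →L[ℂ] H} 
    (hQ : IsStarProjection Q) (h : ∀ ξ, ‖P ξ‖ ^ 2 + ‖Q ξ‖ ^ 2 ≤ ‖ξ‖ ^ 2) : P * Q = 0 := by
  ext ξ
  have h1 : Q (Q ξ) = Q ξ := congrArg (fun T : H →L[ℂ] H => T ξ) hQ.isIdempotentElem.eq
  have h2 := h (Q ξ)
  rw [h1] at h2
  have h3 : ‖P (Q ξ)‖ ^ 2 ≤ 0 := by linarith
  have h4 : ‖P (Q ξ)‖ = 0 := by
    have := sq_nonneg ‖P (Q ξ)‖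
    exact pow_eq_zero_iff (two_ne_zero) |>.1 (le_antisymm h3 this)
  simpa using h4

theorem norm_sum_sq_of_inner_eq_zero {ι : Type*} (s : Finset ι) (v : ι → H)
    (h : ∀ i ∈ s, ∀ j ∈ s, i ≠ j → inner ℂ (v i) (v j) = (0 : ℂ)) :
    ‖∑ i ∈ s, v i‖ ^ 2 = ∑ i ∈ s, ‖v i‖ ^ 2 := by
  classical
  induction s using Finset.induction_on with
  | empty => simp
  | insert a s ha ih =>
    rw [Finset.sum_insert ha, Finset.sum_insert ha, ← ih fun i hi j hj =>
      h i (Finset.mem_insert_of_mem hi) j (Finset.mem_insert_of_mem hj)]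
    have h0 : inner ℂ (v a) (∑ i ∈ s, v i) = (0 : ℂ) := by
      rw [inner_sum]
      refine Finset.sum_eq_zero fun i hi => h a (Finset.mem_insert_self _ _) i
        (Finset.mem_insert_of_mem hi) ?_
      rintro rfl
      exact ha hi
    have := norm_add_sq_eq_norm_sq_add_norm_sq_of_inner_eq_zero _ _ h0
    simpa [sq] using this

theorem inner_apply_apply_eq_zero {P Q : H →L[ℂ] H} (hP : IsStarProjection P) (h : P * Q = 0)
    (ξ η : H) : inner ℂ (P ξ) (Q η) = (0 : ℂ) := by
  have h2 : ContinuousLinearMap.adjoint P = P := hP.isSelfAdjoint.star_eq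
  have h3 : P (Q η) = 0 := congrArg (fun T : H →L[ℂ] H => T η) h
  rw [← h2, ContinuousLinearMap.adjoint_inner_left, h3, inner_zero_right]

/-- The bound by `‖ξ‖²` forces the projections to be pairwise orthogonal, so by Pythagoras their
partial sums are controlled by the partial sums of the `r n ξ`. -/
theorem hasProj_iUnion {S : Set (H →L[ℂ] H)} (r : ℕ → H → ℝ) (h : ∀ n, HasProj S (r n))
    (R : H → ℝ) (hR : ∀ ξ, HasSum (fun n => r n ξ) (R ξ)) (hle : ∀ ξ, R ξ ≤ ‖ξ‖ ^ 2) :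
    HasProj S R := by
  choose P hP hc hr using h
  have hnn : ∀ n ξ, 0 ≤ r n ξ := fun n ξ => by rw [← hr]; positivity
  have horth : ∀ i j, i ≠ j → P i * P j = 0 := by
    intro i j hij
    refine mul_eq_zero_of_norm_sq_add_le (hP j) fun ξ => ?_
    rw [hr, hr]
    refine le_trans ?_ (hle ξ)
    have := sum_le_hasSum {i, j} (fun n _ => hnn n ξ) (hR ξ)
    rwa [Finset.sum_pair hij] at this
  have hnorm : ∀ (s : Finset ℕ) ξ, ‖∑ i ∈ s, P i ξ‖ ^ 2 = ∑ i ∈ s, r i ξ := by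
    intro s ξ
    rw [norm_sum_sq_of_inner_eq_zero]
    · simp [hr]
    · intro i _ j _ hij
      exact inner_apply_apply_eq_zero (hP i) (horth i j hij) _ _
  have happ : ∀ n ξ, (∑ i ∈ Finset.range n, P i) ξ = ∑ i ∈ Finset.range n, P i ξ := by
    intro n ξ; simp
  have hin : ∀ n ξ, (inner ℂ (∑ i ∈ Finset.range n, P i ξ) ξ : ℂ)
      = ((∑ i ∈ Finset.range n, r i ξ : ℝ) : ℂ) := by
    intro n ξ
    rw [sum_inner, Complex.ofReal_sum]
    exact Finset.sum_congr rfl fun i _ => by rw [inner_apply_self_of_isStarProjection (hP i), hr]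
  refine hasProj_of_tendsto (fun n => ∑ i ∈ Finset.range n, P i)
    (fun n u hu => Commute.sum_right _ _ _ fun i _ => hc i u hu)
    (fun n ξ => ∑ i ∈ Finset.range n, r i ξ) (fun ξ => (hR ξ).tendsto_sum_nat.cauchySeq) ?_ ?_ ?_
  · have key : ∀ n m ξ, m ≤ n → ‖(∑ i ∈ Finset.range n, P i) ξ - (∑ i ∈ Finset.range m, P i) ξ‖ ^ 2
      = ∑ i ∈ Finset.range n, r i ξ - ∑ i ∈ Finset.range m, r i ξ := by
      intro n m ξ hmn
      rw [happ, happ, ← Finset.sum_Ico_eq_sub _ hmn, hnorm, Finset.sum_Ico_eq_sub _ hmn]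
    intro n m ξ
    rcases le_total m n with hmn | hmn
    · rw [key n m ξ hmn]; exact le_abs_self _
    · rw [norm_sub_rev, key m n ξ hmn, abs_sub_comm]; exact le_abs_self _
  · intro ξ
    simp only [happ, hin]
    exact (Complex.continuous_ofReal.tendsto _).comp (hR ξ).tendsto_sum_nat
  · intro ξ
    simp only [happ, hnorm]
    exact (hR ξ).tendsto_sum_nat

/-! ### The spectral theorem for bounded self-adjoint operators -/

section Spectral

variable {h : H →L[ℂ] H} (hh : IsSelfAdjoint h)

theorem inner_cfcHom_apply_self (f : C(spectrum ℝ h, ℝ)) (ξ : H) :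
    inner ℂ (cfcHom hh f ξ) ξ = ((inner ℂ (cfcHom hh f ξ) ξ).re : ℂ) := by
  have h1 : IsSelfAdjoint (cfcHom hh f) := by
    rw [IsSelfAdjoint, ← map_star]
    congr 1
  have h2 : ContinuousLinearMap.adjoint (cfcHom hh f) = cfcHom hh f := h1.star_eq
  symm
  apply Complex.conj_eq_iff_re.1
  rw [inner_conj_symm]
  conv_lhs => rw [← h2]
  rw [ContinuousLinearMap.adjoint_inner_right]

/-- The positive functional `f ↦ ⟨f(h) ξ, ξ⟩`. -/
def spectralFunctional (ξ : H) : CompactlySupportedContinuousMap (spectrum ℝ h) ℝ →ₚ[ℝ] ℝ :=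
  PositiveLinearMap.mk₀
    { toFun := fun f => (inner ℂ (cfcHom hh f.toContinuousMap ξ) ξ).re
      map_add' := by
        intro f g
        have : (f + g).toContinuousMap = f.toContinuousMap + g.toContinuousMap := rfl
        rw [this, map_add, add_apply, inner_add_left, Complex.add_re]
      map_smul' := by
        intro c f
        have : (c • f).toContinuousMap = c • f.toContinuousMap := rfl
        rw [this, map_smul, smul_apply, RingHom.id_apply, inner_smul_left_eq_smul]
        simp }
    (by
      intro f hf
      have h1 : 0 ≤ cfcHom hh f.toContinuousMap := (cfcHom_nonneg_iff hh).2 hf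
      have h2 := (ContinuousLinearMap.nonneg_iff_isPositive _).1 h1
      exact (Complex.nonneg_iff.1 (h2.inner_nonneg_left ξ)).1)

/-- The scalar spectral measure of `h` on its spectrum. -/
def specMeasure (ξ : H) : Measure (spectrum ℝ h) :=
  RealRMK.rieszMeasure (spectralFunctional hh ξ)

theorem integral_specMeasure (ξ : H) (f : C(spectrum ℝ h, ℝ)) :
    ∫ x, f x ∂(specMeasure hh ξ) = (inner ℂ (cfcHom hh f ξ) ξ).re :=
  RealRMK.integral_rieszMeasure (spectralFunctional hh ξ)
    (CompactlySupportedContinuousMap.continuousMapEquiv f)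

instance (ξ : H) : IsFiniteMeasure (specMeasure hh ξ) := by
  refine ⟨?_⟩
  unfold specMeasure
  exact isCompact_univ.measure_lt_top

theorem specMeasure_univ (ξ : H) : (specMeasure hh ξ).real Set.univ = ‖ξ‖ ^ 2 := by
  have := integral_specMeasure hh ξ 1
  simp only [ContinuousMap.one_apply, integral_const, smul_eq_mul, mul_one, map_one,
    one_apply_eq_self] at this
  rw [this, inner_self_eq_norm_sq_to_K]
  norm_cast

theorem norm_cfcHom_apply_sq (f : C(spectrum ℝ h, ℝ)) (ξ : H) :
    ‖cfcHom hh f ξ‖ ^ 2 = ∫ x, f x ^ 2 ∂(specMeasure hh ξ) := by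
  have h0 := integral_specMeasure hh ξ (f ^ 2)
  have h1 : ContinuousLinearMap.adjoint (cfcHom hh f) = cfcHom hh f := by
    rw [← ContinuousLinearMap.star_eq_adjoint, ← map_star]
    congr 1
  simp only [ContinuousMap.pow_apply] at h0
  rw [h0, map_pow, sq (cfcHom hh f), mul_apply_eq_comp]
  conv_rhs => rw [← h1]
  rw [ContinuousLinearMap.adjoint_inner_left, h1, inner_self_eq_norm_sq_to_K]
  norm_cast

theorem integrable_specMeasure (ξ : H) (f : C(spectrum ℝ h, ℝ)) :
    Integrable f (specMeasure hh ξ) :=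
  f.continuous.integrable_of_hasCompactSupport (HasCompactSupport.of_compactSpace _)

/-- Since `0 ≤ g - f ≤ 1`, one has `(g - f)² ≤ g - f`. This is the Cauchy estimate needed by
`hasProj_of_tendsto`. -/
theorem norm_cfcHom_sub_apply_sq_le (ξ : H) {f g : C(spectrum ℝ h, ℝ)} (hf : ∀ x, 0 ≤ f x)
    (hfg : ∀ x, f x ≤ g x) (hg : ∀ x, g x ≤ 1) : ‖cfcHom hh g ξ - cfcHom hh f ξ‖ ^ 2
      ≤ ∫ x, g x ∂(specMeasure hh ξ) - ∫ x, f x ∂(specMeasure hh ξ) := by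
  have e1 : cfcHom hh g ξ - cfcHom hh f ξ = cfcHom hh (g - f) ξ := by rw [map_sub, sub_apply]
  have e2 := integral_mono (f := fun x => ((g - f) ^ 2) x) (g := fun x => (g - f) x)
    (integrable_specMeasure hh ξ ((g - f) ^ 2)) (integrable_specMeasure hh ξ (g - f)) fun x => by
      have h1 := hfg x
      have h2 := hf x
      have h3 := hg x
      simp only [ContinuousMap.sub_apply, ContinuousMap.pow_apply]
      nlinarith
  have e3 := integral_specMeasure hh ξ (g - f)
  rw [map_sub, sub_apply, inner_sub_left, Complex.sub_re, ← integral_specMeasure,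
    ← integral_specMeasure] at e3
  rw [e1, norm_cfcHom_apply_sq, ← e3]
  exact e2

theorem exists_antitone_tendsto_indicator {X : Type*} [PseudoEMetricSpace X] {B : Set X}
    (hB : IsClosed B) : ∃ g : ℕ → C(X, ℝ), (∀ n x, 0 ≤ g n x) ∧ (∀ n x, g n x ≤ 1) ∧
      (∀ m n, m ≤ n → ∀ x, g n x ≤ g m x) ∧
      ∀ x, Filter.Tendsto (fun n => g n x) Filter.atTop (nhds (B.indicator 1 x)) := by
  have hδ : ∀ n : ℕ, (0 : ℝ) < 1 / ((n : ℝ) + 1) := fun n => by positivity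
  refine ⟨fun n => ⟨fun x => ((thickenedIndicator (hδ n) B x : ℝ≥0) : ℝ), by fun_prop⟩,
    fun n x => NNReal.coe_nonneg _, fun n x => ?_, fun m n hmn x => ?_, fun x => ?_⟩
  · exact NNReal.coe_le_coe.2 (thickenedIndicator_le_one (hδ n) B x)
  · exact NNReal.coe_le_coe.2
      (thickenedIndicator_mono (hδ n) (hδ m) (Nat.one_div_le_one_div hmn) B x)
  · have h1 := thickenedIndicator_tendsto_indicator_closure hδ
      tendsto_one_div_add_atTop_nhds_zero_nat B
    rw [hB.closure_eq] at h1
    have h3 := (NNReal.continuous_coe.tendsto _).comp ((tendsto_pi_nhds.1 h1) x)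
    have h4 : B.indicator (1 : X → ℝ) x = ((B.indicator (fun _ => (1 : ℝ≥0)) x : ℝ≥0) : ℝ) := by
      by_cases hx : x ∈ B <;> simp [hx]
    rw [h4]
    exact h3

/-- Continuous functions decrease to the indicator of a closed set. The integrals of `g n` and of
its square have the same limit because an indicator equals its square. -/
theorem hasProj_of_isClosed {B : Set (spectrum ℝ h)} (hB : IsClosed B) :
    HasProj {u | Commute h u} fun ξ => (specMeasure hh ξ).real B := by
  obtain ⟨g, hg0, hg1, hanti, hlim⟩ := exists_antitone_tendsto_indicator hB
  have hreal : ∀ ξ, ∫ x, B.indicator 1 x ∂(specMeasure hh ξ) = (specMeasure hh ξ).real B :=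
    fun ξ => integral_indicator_one hB.measurableSet
  have hI : ∀ ξ, Filter.Tendsto (fun n => ∫ x, g n x ∂(specMeasure hh ξ)) Filter.atTop
      (nhds ((specMeasure hh ξ).real B)) := by
    intro ξ
    rw [← hreal]
    refine tendsto_integral_of_dominated_convergence (fun _ => 1)
      (fun n => (g n).continuous.aestronglyMeasurable) (integrable_const _) (fun n => ?_)
      (.of_forall hlim)
    exact .of_forall fun x => by rw [Real.norm_of_nonneg (hg0 n x)]; exact hg1 n x
  have hI2 : ∀ ξ, Filter.Tendsto (fun n => ∫ x, g n x ^ 2 ∂(specMeasure hh ξ)) Filter.atTop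
      (nhds ((specMeasure hh ξ).real B)) := by
    intro ξ
    rw [← hreal]
    refine tendsto_integral_of_dominated_convergence (fun _ => 1)
      (fun n => ((g n).continuous.pow 2).aestronglyMeasurable) (integrable_const _) (fun n => ?_)
      (.of_forall fun x => ?_)
    · exact .of_forall fun x => by
        rw [Real.norm_of_nonneg (sq_nonneg _)]; exact pow_le_one₀ (hg0 n x) (hg1 n x)
    · have := (hlim x).pow 2
      convert this using 2
      by_cases hx : x ∈ B <;> simp [hx]
  refine hasProj_of_tendsto (fun n => cfcHom hh (g n)) ?_
    (fun n ξ => ∫ x, g n x ∂(specMeasure hh ξ)) (fun ξ => (hI ξ).cauchySeq) ?_ ?_ ?_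
  · intro n u hu
    exact (Commute.cfcHom hh hu (by rw [hh.star_eq]; exact hu) (g n)).symm
  · have key : ∀ n m ξ, m ≤ n → ‖cfcHom hh (g n) ξ - cfcHom hh (g m) ξ‖ ^ 2
        ≤ |∫ x, g n x ∂(specMeasure hh ξ) - ∫ x, g m x ∂(specMeasure hh ξ)| := by
      intro n m ξ hmn
      rw [norm_sub_rev, abs_sub_comm]
      exact (norm_cfcHom_sub_apply_sq_le hh ξ (hg0 n) (hanti m n hmn) (hg1 m)).trans
        (le_abs_self _)
    intro n m ξ
    rcases le_total m n with hmn | hmn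
    · exact key n m ξ hmn
    · rw [norm_sub_rev, abs_sub_comm]; exact key m n ξ hmn
  · intro ξ
    have : ∀ n, (inner ℂ (cfcHom hh (g n) ξ) ξ : ℂ) = ((∫ x, g n x ∂(specMeasure hh ξ) : ℝ) : ℂ) :=
      fun n => by rw [inner_cfcHom_apply_self, integral_specMeasure]
    simp only [this]
    exact (Complex.continuous_ofReal.tendsto _).comp (hI ξ)
  · intro ξ
    simp only [norm_cfcHom_apply_sq]
    exact hI2 ξ

/-- Dynkin induction from closed sets: complements correspond to `1 - P`, disjoint unions to
`hasProj_iUnion`. -/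
theorem hasProj_of_measurableSet {B : Set (spectrum ℝ h)} (hB : MeasurableSet B) :
    HasProj {u | Commute h u} fun ξ => (specMeasure hh ξ).real B := by
  refine MeasurableSpace.induction_on_inter
    (C := fun B _ => HasProj {u | Commute h u} fun ξ => (specMeasure hh ξ).real B)
    (BorelSpace.measurable_eq.trans borel_eq_generateFrom_isClosed) isPiSystem_isClosed
    (hasProj_of_isClosed hh isClosed_empty) (fun t ht => hasProj_of_isClosed hh (by simpa using ht))
    (fun t ht ih => ?_) (fun f hd hf ih => ?_) B hB
  · convert ih.one_sub using 2 with ξ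
    rw [← specMeasure_univ hh ξ, measureReal_compl ht]
  · refine hasProj_iUnion (fun n ξ => (specMeasure hh ξ).real (f n)) ih _ (fun ξ => ?_) fun ξ => ?_
    · have h1 := measure_iUnion (μ := specMeasure hh ξ) hd hf
      rw [Measure.real, h1, ENNReal.tsum_toReal_eq fun n => measure_ne_top _ _]
      exact ENNReal.hasSum_toReal (by rw [← h1]; exact measure_ne_top _ _)
    · rw [← specMeasure_univ hh ξ]
      exact measureReal_mono (Set.subset_univ _)

end Spectral

/-! ### Projection-valued measures -/

theorem mem_of_forall_commute {b : H →L[ℂ] H} (h : ∀ u ∈ M.commutant, Commute u b) : b ∈ M := by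
  rw [← M.commutant_commutant, VonNeumannAlgebra.mem_commutant_iff]
  exact fun u hu => (h u hu).eq

theorem commute_of_mem_commutant {a u : H →L[ℂ] H} (ha : a ∈ M) (hu : u ∈ M.commutant) :
    Commute a u :=
  VonNeumannAlgebra.mem_commutant_iff.1 hu a ha

theorem norm_sum_apply_sq {P Q : H →L[ℂ] H} (hP : IsStarProjection P) (h : P * Q = 0) (ξ : H) :
    ‖(P + Q) ξ‖ ^ 2 = ‖P ξ‖ ^ 2 + ‖Q ξ‖ ^ 2 := by
  have := norm_add_sq_eq_norm_sq_add_norm_sq_of_inner_eq_zero _ _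
    (inner_apply_apply_eq_zero hP h ξ ξ)
  simpa [sq] using this

theorem norm_apply_le_of_isStarProjection {P : H →L[ℂ] H} (hP : IsStarProjection P) (ξ : H) :
    ‖P ξ‖ ≤ ‖ξ‖ := by
  have := P.le_opNorm ξ
  have h2 := hP.norm_le
  nlinarith [norm_nonneg ξ]

/-- A family of projections with the quadratic forms of a family of measures is a projection-valued
measure. -/
theorem hasSum_proj_of_norm_sq {X : Type*} [MeasurableSpace X] (μ : H → Measure X)
    [∀ ξ, IsFiniteMeasure (μ ξ)] (F : Set X → H →L[ℂ] H)
    (hμ : ∀ ξ, (μ ξ).real Set.univ = ‖ξ‖ ^ 2)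
    (hF : ∀ B, MeasurableSet B → IsStarProjection (F B))
    (h : ∀ B, MeasurableSet B → ∀ ξ, ‖F B ξ‖ ^ 2 = (μ ξ).real B)
    (B : ℕ → Set X) (hB : ∀ n, MeasurableSet (B n))
    (hd : Pairwise (Function.onFun Disjoint B)) (ξ : H) :
    HasSum (fun n => F (B n) ξ) (F (⋃ n, B n) ξ) := by
  have hmul : ∀ A C, MeasurableSet A → MeasurableSet C → Disjoint A C → F A * F C = 0 := by
    intro A C hA hC hAC
    refine mul_eq_zero_of_norm_sq_add_le (hF C hC) fun ξ => ?_
    rw [h A hA, h C hC, ← measureReal_union hAC hC, ← hμ]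
    exact measureReal_mono (Set.subset_univ _)
  have hadd : ∀ A C, MeasurableSet A → MeasurableSet C → Disjoint A C →
      F (A ∪ C) = F A + F C := by
    intro A C hA hC hAC
    refine isStarProjection_ext (hF _ (hA.union hC)) ((hF A hA).add (hF C hC) (hmul A C hA hC hAC))
      fun ξ => ?_
    rw [norm_sum_apply_sq (hF A hA) (hmul A C hA hC hAC), h _ (hA.union hC), h A hA, h C hC,
      measureReal_union hAC hC]
  have hempty : F ∅ = 0 := by
    ext η
    have := h ∅ MeasurableSet.empty η
    simpa using this
  have hfin : ∀ s : Finset ℕ, F (⋃ n ∈ s, B n) = ∑ n ∈ s, F (B n) := by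
    intro s
    induction s using Finset.induction_on with
    | empty => simpa using hempty
    | insert a s ha ih =>
      rw [Finset.set_biUnion_insert, hadd, ih, Finset.sum_insert ha]
      · exact hB a
      · exact s.measurableSet_biUnion fun n _ => hB n
      · exact Set.disjoint_iUnion₂_right.2 fun n hn => hd (by rintro rfl; exact ha hn)
  have hU : MeasurableSet (⋃ n, B n) := MeasurableSet.iUnion hB
  -- By finite additivity the remainder is the projection of the leftover set, so its squared norm
  -- is the missing mass.
  have hdiff : ∀ s : Finset ℕ, ‖∑ n ∈ s, F (B n) ξ - F (⋃ n, B n) ξ‖ ^ 2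
      = (μ ξ).real (⋃ n, B n) - ∑ n ∈ s, (μ ξ).real (B n) := by
    intro s
    have hs : MeasurableSet (⋃ n ∈ s, B n) := s.measurableSet_biUnion fun n _ => hB n
    have hsub : (⋃ n ∈ s, B n) ⊆ ⋃ n, B n := Set.iUnion₂_subset fun n _ => Set.subset_iUnion B n
    have e1 : F (⋃ n, B n) = F (⋃ n ∈ s, B n) + F ((⋃ n, B n) \ ⋃ n ∈ s, B n) := by
      rw [← hadd _ _ hs (hU.diff hs) Set.disjoint_sdiff_right, Set.union_sdiff_cancel hsub]
    rw [norm_sub_rev, e1, hfin, add_apply, sum_apply, add_sub_cancel_left, h _ (hU.diff hs),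
      measureReal_sdiff hsub hs,
      measureReal_biUnion_finset (fun i _ j _ hij => hd hij) fun n _ => hB n]
  have hsum : HasSum (fun n => (μ ξ).real (B n)) ((μ ξ).real (⋃ n, B n)) := by
    have h1 := measure_iUnion (μ := μ ξ) hd hB
    rw [Measure.real, h1, ENNReal.tsum_toReal_eq fun n => measure_ne_top _ _]
    exact ENNReal.hasSum_toReal (by rw [← h1]; exact measure_ne_top _ _)
  rw [HasSum, SummationFilter.unconditional_filter, tendsto_iff_norm_sub_tendsto_zero]
  have h0 : Filter.Tendsto (fun s : Finset ℕ => ‖∑ n ∈ s, F (B n) ξ - F (⋃ n, B n) ξ‖ ^ 2)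
      Filter.atTop (nhds 0) := by
    simp only [hdiff]
    have := (tendsto_const_nhds (x := (μ ξ).real (⋃ n, B n))).sub hsum
    simpa using this
  have := (Real.continuous_sqrt.tendsto _).comp h0
  simpa [Function.comp_def, Real.sqrt_sq (norm_nonneg _)] using this

theorem isStarProjection_coe {a : M.toStarSubalgebra} (ha : IsStarProjection a) :
    IsStarProjection (a : H →L[ℂ] H) :=
  ⟨congrArg Subtype.val ha.isIdempotentElem.eq, congrArg Subtype.val ha.isSelfAdjoint.star_eq⟩

theorem PVM.scalarMeasure_apply (E : PVM M) (ξ : H) {B : Set ℝ≥0} (hB : MeasurableSet B) :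
    E.scalarMeasure ξ B = ENNReal.ofReal (‖(E.proj B : H →L[ℂ] H) ξ‖ ^ 2) := by
  rw [PVM.scalarMeasure, Measure.ofMeasurable_apply _ hB]
  congr 1
  rw [← inner_conj_symm, inner_apply_self_of_isStarProjection
    (isStarProjection_coe (E.isStarProjection B hB)), Complex.conj_ofReal, Complex.ofReal_re]

theorem PVM.proj_union (E : PVM M) {B C : Set ℝ≥0} (hB : MeasurableSet B) (hC : MeasurableSet C)
    (hBC : Disjoint B C) : E.proj (B ∪ C) = E.proj B + E.proj C := by
  apply Subtype.ext
  ext ξ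
  let f : ℕ → Set ℝ≥0 := fun n => if n = 0 then B else if n = 1 then C else ∅
  have hf : ∀ n, MeasurableSet (f n) := by
    intro n
    simp only [f]
    split_ifs <;> measurability
  have hd : Pairwise (Function.onFun Disjoint f) := by
    intro i j hij
    simp only [Function.onFun, f]
    split_ifs <;> first | omega | exact hBC | exact hBC.symm | simp
  have hU : ⋃ n, f n = B ∪ C := by
    ext t
    simp only [Set.mem_iUnion, Set.mem_union, f]
    constructor
    · rintro ⟨n, hn⟩
      split_ifs at hn
      · exact Or.inl hn
      · exact Or.inr hn
      · exact absurd hn (Set.notMem_empty t)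
    · rintro (h | h)
      · exact ⟨0, by simpa using h⟩
      · exact ⟨1, by simpa using h⟩
  have h1 := E.hasSum f hf hd ξ
  rw [hU] at h1
  have h2 := hasSum_sum_of_ne_finset_zero (L := .unconditional ℕ) (f := fun n => (E.proj (f n) : H →L[ℂ] H) ξ)
    (s := Finset.range 2) (fun n hn => by
      have : f n = ∅ := by
        simp only [Finset.mem_range, not_lt] at hn
        simp only [f]
        rw [if_neg (by omega), if_neg (by omega)]
      simp [this, E.proj_empty])
  rw [h1.unique h2]
  simp [Finset.sum_range_succ, f]

theorem PVM.mul_eq_zero (E : PVM M) {B C : Set ℝ≥0} (hB : MeasurableSet B) (hC : MeasurableSet C)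
    (hBC : Disjoint B C) : E.proj B * E.proj C = 0 := by
  have h1 := isStarProjection_coe (E.isStarProjection B hB)
  have h2 := isStarProjection_coe (E.isStarProjection C hC)
  have h3 := isStarProjection_coe (E.isStarProjection _ (hB.union hC))
  apply Subtype.ext
  refine mul_eq_zero_of_norm_sq_add_le h2 fun ξ => ?_
  have h4 : ((E.proj (B ∪ C) : M.toStarSubalgebra) : H →L[ℂ] H)
      = (E.proj B : H →L[ℂ] H) + (E.proj C : H →L[ℂ] H) :=
    congrArg Subtype.val (E.proj_union hB hC hBC)
  have h5 := inner_apply_self_of_isStarProjection h3 ξ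
  conv_lhs at h5 => rw [h4]
  rw [add_apply, inner_add_left, inner_apply_self_of_isStarProjection h1,
    inner_apply_self_of_isStarProjection h2] at h5
  have h6 : ‖(E.proj B : H →L[ℂ] H) ξ‖ ^ 2 + ‖(E.proj C : H →L[ℂ] H) ξ‖ ^ 2
      = ‖(E.proj (B ∪ C) : H →L[ℂ] H) ξ‖ ^ 2 := by exact_mod_cast h5
  rw [h6]
  have := norm_apply_le_of_isStarProjection h3 ξ
  gcongr

theorem PVM.proj_compl (E : PVM M) {B : Set ℝ≥0} (hB : MeasurableSet B) :
    E.proj Bᶜ = 1 - E.proj B := by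
  rw [← E.univ, ← Set.union_compl_self B, E.proj_union hB hB.compl disjoint_compl_right,
    add_sub_cancel_left]

theorem PVM.scalarMeasure_univ (E : PVM M) (ξ : H) :
    E.scalarMeasure ξ Set.univ = ENNReal.ofReal (‖ξ‖ ^ 2) := by
  rw [E.scalarMeasure_apply ξ MeasurableSet.univ, E.univ]
  rfl

theorem PVM.scalarMeasure_compl_eq_zero (E : PVM M) {B : Set ℝ≥0} (hB : MeasurableSet B) {ξ : H}
    (hξ : (E.proj B : H →L[ℂ] H) ξ = ξ) : E.scalarMeasure ξ Bᶜ = 0 := by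
  rw [E.scalarMeasure_apply ξ hB.compl, E.proj_compl hB]
  have : ((1 - E.proj B : M.toStarSubalgebra) : H →L[ℂ] H) ξ = 0 := by
    change ξ - (E.proj B : H →L[ℂ] H) ξ = 0
    rw [hξ, sub_self]
  rw [this]
  simp

theorem PVM.lintegral_scalarMeasure_le (E : PVM M) {B : Set ℝ≥0} (hB : MeasurableSet B) {ξ : H}
    (hξ : (E.proj B : H →L[ℂ] H) ξ = ξ) {f : ℝ≥0 → ℝ≥0∞} {c : ℝ≥0∞} (hf : ∀ t ∈ B, f t ≤ c) :
    ∫⁻ t, f t ∂(E.scalarMeasure ξ) ≤ c * ENNReal.ofReal (‖ξ‖ ^ 2) := by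
  rw [← E.scalarMeasure_univ, ← lintegral_const]
  refine lintegral_mono_ae ?_
  rw [ae_iff]
  refine measure_mono_null (fun t ht => ?_) (E.scalarMeasure_compl_eq_zero hB hξ)
  exact fun h => ht (hf t h)

instance (E : PVM M) (ξ : H) : IsFiniteMeasure (E.scalarMeasure ξ) :=
  ⟨by rw [E.scalarMeasure_univ]; exact ENNReal.ofReal_lt_top⟩

/-- The spectral theorem for a positive element of a von Neumann algebra. -/
theorem exists_pvm {h : H →L[ℂ] H} (hm : h ∈ M) (h0 : 0 ≤ h) :
    ∃ E : PVM M, E.proj (Set.Iic ‖h‖₊) = 1 ∧ ∀ (f : ℝ → ℝ), Continuous f → ∀ ξ : H,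
      (inner ℂ (cfc f h ξ) ξ).re = ∫ t, f t ∂(E.scalarMeasure ξ) := by
  classical
  have hh : IsSelfAdjoint h := h0.isSelfAdjoint
  -- Transport from the spectrum to `[0, ∞)`; truncation changes nothing because `h` is positive.
  let g : spectrum ℝ h → ℝ≥0 := fun x => (x : ℝ).toNNReal
  have hg : Measurable g := by fun_prop
  have hgv : ∀ x : spectrum ℝ h, ((g x : ℝ≥0) : ℝ) = x := fun x =>
    Real.coe_toNNReal _ (spectrum_nonneg_of_nonneg h0 x.2)
  choose P hP hPc hPn using fun B : {B : Set (spectrum ℝ h) // MeasurableSet B} =>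
    hasProj_of_measurableSet hh B.2
  have hPM : ∀ B, P B ∈ M := fun B => mem_of_forall_commute fun u hu =>
    hPc B u (commute_of_mem_commutant hm hu)
  -- The value 0 on non-Borel sets is harmless: `PVM` constrains Borel sets only.
  let F : Set ℝ≥0 → H →L[ℂ] H := fun B =>
    if hB : MeasurableSet B then P ⟨g ⁻¹' B, hg hB⟩ else 0
  have hFM : ∀ B, F B ∈ M := by
    intro B
    simp only [F]
    split_ifs
    · exact hPM _
    · exact zero_mem M
  have hFP : ∀ B, MeasurableSet B → IsStarProjection (F B) := fun B hB => by
    simp only [F, dif_pos hB]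
    exact hP _
  have hFn : ∀ B, MeasurableSet B → ∀ ξ, ‖F B ξ‖ ^ 2 = ((specMeasure hh ξ).map g).real B := by
    intro B hB ξ
    simp only [F, dif_pos hB]
    rw [hPn, map_measureReal_apply hg hB]
  have huniv : ∀ ξ, ((specMeasure hh ξ).map g).real Set.univ = ‖ξ‖ ^ 2 := fun ξ => by
    rw [map_measureReal_apply hg MeasurableSet.univ, Set.preimage_univ, specMeasure_univ]
  have : ∀ ξ, IsFiniteMeasure ((specMeasure hh ξ).map g) := fun ξ =>
    Measure.isFiniteMeasure_map _ _
  let E : PVM M :=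
    { proj := fun B => ⟨F B, hFM B⟩
      isStarProjection := fun B hB =>
        ⟨Subtype.ext (hFP B hB).isIdempotentElem.eq, Subtype.ext (hFP B hB).isSelfAdjoint.star_eq⟩
      univ := by
        apply Subtype.ext
        refine isStarProjection_ext (hFP _ MeasurableSet.univ) (.one _) fun ξ => ?_
        rw [hFn _ MeasurableSet.univ, huniv]
        rfl
      hasSum := hasSum_proj_of_norm_sq (fun ξ => (specMeasure hh ξ).map g) F huniv hFP hFn }
  have hE : ∀ ξ, E.scalarMeasure ξ = (specMeasure hh ξ).map g := by
    intro ξ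
    ext B hB
    rw [E.scalarMeasure_apply ξ hB]
    change ENNReal.ofReal (‖F B ξ‖ ^ 2) = _
    rw [hFn B hB, Measure.real, ENNReal.ofReal_toReal (measure_ne_top _ _)]
  refine ⟨E, ?_, fun f hf ξ => ?_⟩
  · apply Subtype.ext
    refine isStarProjection_ext (hFP _ measurableSet_Iic) (.one _) fun ξ => ?_
    have : g ⁻¹' Set.Iic ‖h‖₊ = Set.univ := by
      refine Set.eq_univ_of_forall fun x => ?_
      rw [Set.mem_preimage, Set.mem_Iic, ← NNReal.coe_le_coe, hgv, coe_nnnorm]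
      exact (le_abs_self _).trans ((spectrum.norm_le_norm_mul_of_mem x.2).trans
        (mul_le_of_le_one_right (norm_nonneg _) ContinuousLinearMap.norm_id_le))
    rw [hFn _ measurableSet_Iic, map_measureReal_apply hg measurableSet_Iic, this, specMeasure_univ]
    rfl
  rw [hE, integral_map hg.aemeasurable (by fun_prop), cfc_apply f h, ← integral_specMeasure]
  refine integral_congr_ae (.of_forall fun x => ?_)
  simp only [hgv]
  rfl

/-! ### Young functions -/

/-- As `g(0) = 0` and `g > 0` afterwards, monotonicity extends to the endpoint 0, which gives
interval integrability from 0. -/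
theorem IsYoung.exists_density {φ : ℝ → ℝ} (hφ : IsYoung φ) : ∃ g : ℝ → ℝ,
    MonotoneOn g (Set.Ici 0) ∧ (∀ s, 0 ≤ s → 0 ≤ g s) ∧ 0 < g 1 ∧
    ∀ t, 0 ≤ t → φ t = ∫ s in (0 : ℝ)..t, g s := by
  obtain ⟨g, g0, gpos, -, -, gm, hg⟩ := hφ
  have hnn : ∀ s, 0 ≤ s → 0 ≤ g s := by
    intro s hs
    rcases hs.eq_or_lt with rfl | hs
    · exact g0.ge
    · exact (gpos s hs).le
  refine ⟨g, fun s hs t ht hst => ?_, hnn, gpos 1 one_pos, hg⟩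
  rcases (Set.mem_Ici.1 hs).eq_or_lt with rfl | hs
  · rw [g0]; exact hnn t ht
  · exact gm hs (hs.trans_le hst) hst

theorem intervalIntegrable_of_monotoneOn_Ici {g : ℝ → ℝ} (hg : MonotoneOn g (Set.Ici 0)) {a b : ℝ}
    (ha : 0 ≤ a) (hb : 0 ≤ b) : IntervalIntegrable g volume a b :=
  (hg.mono fun _ hx => (le_min ha hb).trans hx.1).intervalIntegrable

theorem IsYoung.monotone {φ : ℝ → ℝ} (hφ : IsYoung φ) {s t : ℝ} (hs : 0 ≤ s) (hst : s ≤ t) :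
    φ s ≤ φ t := by
  obtain ⟨g, gm, gnn, -, hg⟩ := hφ.exists_density
  have ht := hs.trans hst
  rw [hg s hs, hg t ht, ← sub_nonneg, intervalIntegral.integral_interval_sub_left
    (intervalIntegrable_of_monotoneOn_Ici gm le_rfl ht)
    (intervalIntegrable_of_monotoneOn_Ici gm le_rfl hs)]
  exact intervalIntegral.integral_nonneg hst fun u hu => gnn u (hs.trans hu.1)

theorem IsYoung.exists_le {φ : ℝ → ℝ} (hφ : IsYoung φ) {ε : ℝ} (hε : 0 < ε) :
    ∃ d : ℝ, 0 < d ∧ φ d ≤ ε := by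
  obtain ⟨g, gm, gnn, g1, hg⟩ := hφ.exists_density
  -- The density is at most `g 1` on `[0, 1]`.
  refine ⟨min 1 (ε / g 1), by positivity, ?_⟩
  have hd : (0 : ℝ) ≤ min 1 (ε / g 1) := by positivity
  rw [hg _ hd]
  have h1 : ∫ s in (0 : ℝ)..min 1 (ε / g 1), g s ≤ ∫ s in (0 : ℝ)..min 1 (ε / g 1), g 1 :=
    intervalIntegral.integral_mono_on hd (intervalIntegrable_of_monotoneOn_Ici gm le_rfl hd)
      (by simp) fun x hx => gm hx.1 (Set.mem_Ici.2 zero_le_one) (hx.2.trans (min_le_left _ _))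
  refine h1.trans ?_
  rw [intervalIntegral.integral_const, smul_eq_mul, sub_zero, ← le_div_iff₀ g1]
  exact min_le_right _ _

theorem IsYoung.exists_ge {φ : ℝ → ℝ} (hφ : IsYoung φ) (C : ℝ) : ∃ t : ℝ, 0 ≤ t ∧ C ≤ φ t := by
  obtain ⟨g, gm, gnn, g1, hg⟩ := hφ.exists_density
  have ht : (1 : ℝ) ≤ 1 + |C| / g 1 := by
    have : 0 ≤ |C| / g 1 := by positivity
    linarith
  have ht0 : (0 : ℝ) ≤ 1 + |C| / g 1 := zero_le_one.trans ht
  -- Past 1 the density is at least `g 1`, so an interval of length `|C| / g 1` contributes at least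
  -- `|C|`.
  refine ⟨1 + |C| / g 1, ht0, ?_⟩
  have h2 : (∫ s in (1 : ℝ)..(1 + |C| / g 1), g 1) ≤ ∫ s in (1 : ℝ)..(1 + |C| / g 1), g s :=
    intervalIntegral.integral_mono_on ht (by simp)
      (intervalIntegrable_of_monotoneOn_Ici gm zero_le_one ht0)
      fun x hx => gm (Set.mem_Ici.2 zero_le_one) (Set.mem_Ici.2 (zero_le_one.trans hx.1)) hx.1
  rw [intervalIntegral.integral_const, smul_eq_mul, add_sub_cancel_left,
    div_mul_cancel₀ _ g1.ne'] at h2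
  have h3 := intervalIntegral.integral_add_adjacent_intervals
    (intervalIntegrable_of_monotoneOn_Ici gm le_rfl zero_le_one)
    (intervalIntegrable_of_monotoneOn_Ici gm zero_le_one ht0)
  have h4 : 0 ≤ ∫ s in (0 : ℝ)..1, g s :=
    intervalIntegral.integral_nonneg zero_le_one fun u hu => gnn u hu.1
  rw [hg _ ht0, ← h3]
  linarith [le_abs_self C]

/-! ### The trace -/

theorem FiniteTrace.val_nonneg (τ : FiniteTrace M) {a : M.toStarSubalgebra} (ha : 0 ≤ a) :
    0 ≤ τ.val a := (τ.nonneg a ha).1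

theorem FiniteTrace.val_mono (τ : FiniteTrace M) {a b : M.toStarSubalgebra} (h : a ≤ b) :
    τ.val a ≤ τ.val b := by
  have h1 : 0 ≤ b - a := by
    change (0 : H →L[ℂ] H) ≤ (b : H →L[ℂ] H) - (a : H →L[ℂ] H)
    exact sub_nonneg.2 h
  have := τ.val_nonneg h1
  simp only [FiniteTrace.val, map_sub, Complex.sub_re] at this ⊢
  linarith

theorem FiniteTrace.val_pos (τ : FiniteTrace M) {p : Proj M} (hp : p.op ≠ 0) : 0 < τ.val p.1 := by
  have h0 := nonneg_of_isStarProjection p.2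
  refine (τ.val_nonneg h0).lt_of_ne fun h => hp ?_
  have h1 : τ.toLinearMap p.1 = 0 := Complex.ext h.symm (τ.nonneg _ h0).2
  have := τ.faithful _ h0 h1
  simp [Proj.op, this]

theorem FiniteTrace.spectralDistribution_apply (τ : FiniteTrace M) (E : PVM M) {B : Set ℝ≥0}
    (hB : MeasurableSet B) :
    τ.spectralDistribution E B = ENNReal.ofReal (τ.val (E.proj B)) := by
  rw [FiniteTrace.spectralDistribution, Measure.ofMeasurable_apply _ hB]

/-! ### Affiliation and the commutant -/

/-- Affiliation only speaks of unitaries, but every element of the C*-algebra `M'` is a combination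
of four unitaries; then `M'' = M`. -/
theorem mem_of_forall_unitary_commute {b : H →L[ℂ] H}
    (h : ∀ u ∈ M.commutant, u ∈ unitary (H →L[ℂ] H) → Commute u b) : b ∈ M := by
  refine mem_of_forall_commute fun u hu => ?_
  have hcl : IsClosed (M.commutant : Set (H →L[ℂ] H)) := by
    rw [VonNeumannAlgebra.coe_commutant]
    exact Set.isClosed_centralizer _
  let _ : CStarAlgebra M.commutant.toStarSubalgebra :=
    StarSubalgebra.cstarAlgebra M.commutant.toStarSubalgebra (h_closed := hcl)
  obtain ⟨v, c, hv, -⟩ := CStarAlgebra.exists_sum_four_unitary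
    (⟨u, hu⟩ : M.commutant.toStarSubalgebra)
  have hu' : u = ∑ i, c i • ((v i : M.commutant.toStarSubalgebra) : H →L[ℂ] H) := by
    have := congrArg (M.commutant.toStarSubalgebra.subtype) hv
    simpa using this
  rw [hu']
  refine Commute.sum_left _ _ _ fun i _ => Commute.smul_left (h _ (v i).1.2 ?_) _
  exact ⟨congrArg Subtype.val (Unitary.mem_iff.1 (v i).2).1,
    congrArg Subtype.val (Unitary.mem_iff.1 (v i).2).2⟩

theorem Affiliated.mem_graph {x : H →ₗ.[ℂ] H} (hx : Affiliated M x) {u : H →L[ℂ] H}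
    (hu : u ∈ M.commutant) (hu' : u ∈ unitary (H →L[ℂ] H)) {ξ η : H} (h : (ξ, η) ∈ x.graph) :
    (u ξ, u η) ∈ x.graph := by
  rw [LinearPMap.mem_graph_iff] at h ⊢
  obtain ⟨y, rfl, rfl⟩ := h
  obtain ⟨h1, h2⟩ := hx u hu hu' y
  exact ⟨⟨u y, h1⟩, rfl, h2.symm⟩

theorem Proj.op_mem (p : Proj M) : p.op ∈ M := p.1.2

theorem Proj.isStarProjection_op (p : Proj M) : IsStarProjection p.op := isStarProjection_coe p.2

theorem Proj.op_op (p : Proj M) : p.op * p.op = p.op := p.isStarProjection_op.isIdempotentElem.eq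

theorem Proj.op_op_apply (p : Proj M) (ξ : H) : p.op (p.op ξ) = p.op ξ :=
  congrArg (fun T : H →L[ℂ] H => T ξ) p.op_op

theorem Proj.ext_op {p q : Proj M} (h : p.op = q.op) : p = q := Subtype.ext (Subtype.ext h)

/-- The projection of `M` given by an operator. -/
def Proj.mk (p : H →L[ℂ] H) (hm : p ∈ M) (hp : IsStarProjection p) : Proj M :=
  ⟨⟨p, hm⟩, ⟨Subtype.ext hp.isIdempotentElem.eq, Subtype.ext hp.isSelfAdjoint.star_eq⟩⟩

/-- Commutativity places the symmetry `2p - 1` among the unitaries of `M'`, so it preserves the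
graph; averaging it with the identity gives `p`. -/
theorem Affiliated.proj_mem_graph {x : H →ₗ.[ℂ] H} (hM : ∀ a ∈ M, ∀ b ∈ M, a * b = b * a)
    (hx : Affiliated M x) (p : Proj M) {ξ η : H} (h : (ξ, η) ∈ x.graph) :
    (p.op ξ, p.op η) ∈ x.graph := by
  have hu := p.isStarProjection_op.two_mul_sub_one_mem_unitary
  have hc : 2 * p.op - 1 ∈ M.commutant := by
    rw [VonNeumannAlgebra.mem_commutant_iff]
    exact fun a ha => hM a ha _ (sub_mem (by rw [two_mul]; exact add_mem p.op_mem p.op_mem)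
      (one_mem M))
  have h1 := hx.mem_graph hc hu h
  have h2 := x.graph.smul_mem (2⁻¹ : ℂ) (x.graph.add_mem h1 h)
  convert h2 using 1
  ext <;> simp [two_mul] <;> rw [← add_smul] <;> norm_num

theorem PVM.proj_mem (E : PVM M) (B : Set ℝ≥0) : (E.proj B : H →L[ℂ] H) ∈ M := (E.proj B).2

/-- The spectral projection of a Borel set, as an element of `P(M)`. -/
def PVM.toProj (E : PVM M) (B : Set ℝ≥0) (hB : MeasurableSet B) : Proj M :=
  ⟨E.proj B, E.isStarProjection B hB⟩

/-! ### Cutting measurable operators down to bounded ones -/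

/-- `e` maps into the domain of `T`, and `T e = b`. -/
def Cut (T : H →ₗ.[ℂ] H) (e b : H →L[ℂ] H) : Prop := ∀ ξ, (e ξ, b ξ) ∈ T.graph

theorem Cut.unique {T : H →ₗ.[ℂ] H} {e b c : H →L[ℂ] H} (hb : Cut T e b) (hc : Cut T e c) :
    b = c := by
  ext ξ
  exact T.mem_graph_snd_inj (hb ξ) (hc ξ) rfl

theorem Cut.mul {T : H →ₗ.[ℂ] H} {e b : H →L[ℂ] H} (hb : Cut T e b) (a : H →L[ℂ] H) :
    Cut T (e * a) (b * a) := fun ξ => hb (a ξ)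

theorem Cut.mono {S T : H →ₗ.[ℂ] H} {e b : H →L[ℂ] H} (hb : Cut S e b) (h : S ≤ T) : Cut T e b :=
  fun ξ => LinearPMap.le_graph_of_le h (hb ξ)

theorem PVM.tendsto_proj_Iic (E : PVM M) (ξ : H) :
    Filter.Tendsto (fun n : ℕ => (E.proj (Set.Iic (n : ℝ≥0)) : H →L[ℂ] H) ξ) Filter.atTop
      (nhds ξ) := by
  have h1 : Filter.Tendsto (fun n : ℕ => E.scalarMeasure ξ (Set.Iic (n : ℝ≥0))ᶜ) Filter.atTop
      (nhds 0) := by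
    have h := tendsto_measure_iInter_atTop (μ := E.scalarMeasure ξ)
      (s := fun n : ℕ => (Set.Iic (n : ℝ≥0))ᶜ) (fun n => measurableSet_Iic.compl.nullMeasurableSet)
      (fun n m hnm => Set.compl_subset_compl.2 (Set.Iic_subset_Iic.2 (by exact_mod_cast hnm)))
      ⟨0, measure_ne_top _ _⟩
    have h2 : ⋂ n : ℕ, (Set.Iic (n : ℝ≥0))ᶜ = ∅ := by
      ext t
      obtain ⟨n, hn⟩ := exists_nat_ge t
      simp only [Set.mem_iInter, Set.mem_compl_iff, Set.mem_Iic, Set.mem_empty_iff_false,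
        iff_false, not_forall, not_not]
      exact ⟨n, hn⟩
    rwa [h2, measure_empty] at h
  have h2 : ∀ n : ℕ, E.scalarMeasure ξ (Set.Iic (n : ℝ≥0))ᶜ
      = ENNReal.ofReal (‖(E.proj (Set.Iic (n : ℝ≥0)) : H →L[ℂ] H) ξ - ξ‖ ^ 2) := by
    intro n
    rw [E.scalarMeasure_apply ξ measurableSet_Iic.compl, E.proj_compl measurableSet_Iic,
      norm_sub_rev]
    rfl
  simp only [h2] at h1
  rw [tendsto_iff_norm_sub_tendsto_zero]
  have h3 := (ENNReal.tendsto_toReal ENNReal.zero_ne_top).comp h1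
  have h4 := (Real.continuous_sqrt.tendsto _).comp h3
  simpa [Function.comp_def, ENNReal.toReal_ofReal, sq_nonneg, Real.sqrt_sq] using h4

/-- The scalar measure of such a vector is carried by `[0, c]`, so its second moment, which decides
the domain and equals `‖xξ‖²`, is at most `c²‖ξ‖²`. -/
theorem IsModulusSpectralMeasure.apply_le {x : H →ₗ.[ℂ] H} {E : PVM M}
    (h : IsModulusSpectralMeasure x E) (c : ℝ≥0) {ξ : H}
    (hξ : (E.proj (Set.Iic c) : H →L[ℂ] H) ξ = ξ) :
    ∃ hd : ξ ∈ x.domain, ‖x ⟨ξ, hd⟩‖ ≤ c * ‖ξ‖ := by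
  have h1 := E.lintegral_scalarMeasure_le measurableSet_Iic hξ (f := fun t => (t : ℝ≥0∞) ^ 2)
    (c := (c : ℝ≥0∞) ^ 2) fun t ht => pow_le_pow_left' (by exact_mod_cast ht) 2
  have hd : ξ ∈ x.domain := by
    rw [h.1]
    refine h1.trans_lt (ENNReal.mul_lt_top ?_ ENNReal.ofReal_lt_top)
    exact ENNReal.pow_lt_top ENNReal.coe_lt_top
  refine ⟨hd, ?_⟩
  have h2 := h.2 ⟨ξ, hd⟩
  rw [← h2] at h1
  have h3 : (c : ℝ≥0∞) ^ 2 * ENNReal.ofReal (‖ξ‖ ^ 2) = ENNReal.ofReal ((c * ‖ξ‖) ^ 2) := by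
    rw [mul_pow, ENNReal.ofReal_mul (by positivity), ENNReal.ofReal_pow (NNReal.coe_nonneg c),
      ENNReal.ofReal_coe_nnreal]
  rw [h3, ENNReal.ofReal_le_ofReal_iff (by positivity)] at h1
  exact le_of_sq_le_sq h1 (by positivity)

theorem IsModulusSpectralMeasure.exists_cut {x : H →ₗ.[ℂ] H} {E : PVM M}
    (h : IsModulusSpectralMeasure x E) (hx : Affiliated M x) (c : ℝ≥0) :
    ∃ b ∈ M, Cut x (E.proj (Set.Iic c) : H →L[ℂ] H) b := by
  set e : H →L[ℂ] H := (E.proj (Set.Iic c) : H →L[ℂ] H) with he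
  have hP : IsStarProjection e := isStarProjection_coe (E.isStarProjection _ measurableSet_Iic)
  have hee : ∀ ξ, e (e ξ) = e ξ := fun ξ =>
    congrArg (fun T : H →L[ℂ] H => T ξ) hP.isIdempotentElem.eq
  have hd : ∀ ξ, e ξ ∈ x.domain := fun ξ => (h.apply_le c (hee ξ)).1
  let b : H →ₗ[ℂ] H := x.toFun.comp ((e : H →ₗ[ℂ] H).codRestrict x.domain hd)
  have hb : ∀ ξ, b ξ = x ⟨e ξ, hd ξ⟩ := fun ξ => rfl
  have hbound : ∀ ξ, ‖b ξ‖ ≤ c * ‖ξ‖ := fun ξ => by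
    obtain ⟨_, h1⟩ := h.apply_le c (hee ξ)
    exact h1.trans (mul_le_mul_of_nonneg_left (norm_apply_le_of_isStarProjection hP ξ) c.2)
  have hcut : Cut x e (b.mkContinuous c hbound) := fun ξ =>
    (x.mem_graph_iff).2 ⟨⟨e ξ, hd ξ⟩, rfl, rfl⟩
  refine ⟨b.mkContinuous c hbound, mem_of_forall_unitary_commute fun u hu hu' => ?_, hcut⟩
  ext ξ
  have h1 := hx.mem_graph hu hu' (hcut ξ)
  have h2 : u (e ξ) = e (u ξ) := congrArg (fun T : H →L[ℂ] H => T ξ)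
    (commute_of_mem_commutant (E.proj_mem _) hu).eq.symm
  exact x.mem_graph_snd_inj h1 (hcut (u ξ)) h2

theorem exists_cut_of_mem_orliczSpace {τ : FiniteTrace M} {φ : ℝ → ℝ} {x : H →ₗ.[ℂ] H}
    (hx : x ∈ orliczSpace τ φ) : ∃ (e : ℕ → Proj M) (b : ℕ → H →L[ℂ] H), (∀ n, b n ∈ M) ∧
      (∀ n, Cut x (e n).op (b n)) ∧
      ∀ ξ, Filter.Tendsto (fun n => (e n).op ξ) Filter.atTop (nhds ξ) := by
  obtain ⟨k, -, y, ⟨hy, E, hE, -⟩, rfl⟩ := hx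
  choose b hb hc using fun n : ℕ => hE.exists_cut hy.2.1 (n : ℝ≥0)
  refine ⟨fun n => E.toProj (Set.Iic (n : ℝ≥0)) measurableSet_Iic, fun n => (k : ℂ) • b n,
    fun n => ?_, fun n ξ => ?_, E.tendsto_proj_Iic⟩
  · exact M.toStarSubalgebra.smul_mem (hb n) _
  · have h := hc n ξ
    rw [LinearPMap.mem_graph_iff] at h ⊢
    obtain ⟨v, h1, h2⟩ := h
    exact ⟨v, h1, by rw [LinearPMap.smul_apply, h2]; rfl⟩

/-- A lower bound for an operator on the range of a projection bounds the trace of the latter. -/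
theorem young_mul_trace_le_one {τ : FiniteTrace M} {φ : ℝ → ℝ} (hφ : IsYoung φ)
    (hM : ∀ a ∈ M, ∀ b ∈ M, a * b = b * a) {y : H →ₗ.[ℂ] H} (hy : y ∈ orliczUnitBall τ φ)
    (r : Proj M) {b : H →L[ℂ] H} (hb : Cut y r.op b) {c : ℝ}
    (hc : ∀ ξ, c * ‖r.op ξ‖ ≤ ‖b ξ‖) {t : ℝ} (ht : 0 ≤ t) (htc : t < c) :
    φ t * τ.val r.1 ≤ 1 := by
  obtain ⟨hym, E, hE, hint⟩ := hy
  lift t to ℝ≥0 using ht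
  set e : H →L[ℂ] H := (E.proj (Set.Iic t) : H →L[ℂ] H) with he
  have hP : IsStarProjection e := isStarProjection_coe (E.isStarProjection _ measurableSet_Iic)
  have hcomm : r.op * e = e * r.op := hM _ r.op_mem _ (E.proj_mem _)
  -- A common fixed vector `η` satisfies `c‖η‖ ≤ ‖yη‖ ≤ t‖η‖` with `t < c`, so it vanishes.
  have hzero : r.op * e = 0 := by
    ext ξ
    set η := (r.op * e) ξ with hη
    have h1 : e η = η := by
      rw [hη, hcomm, mul_apply_eq_comp, ← mul_apply_eq_comp e e, hP.isIdempotentElem.eq]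
    have h2 : r.op η = η := by
      rw [hη, mul_apply_eq_comp, r.op_op_apply]
    obtain ⟨hd, h3⟩ := hE.apply_le t h1
    have h4 := hb η
    rw [h2] at h4
    have h5 : y ⟨η, hd⟩ = b η := by
      rw [LinearPMap.mem_graph_iff] at h4
      obtain ⟨v, hv1, hv2⟩ := h4
      change _ = (η, b η).2
      rw [← hv2]
      congr 1
      exact Subtype.ext hv1.symm
    rw [h5] at h3
    have h6 := hc η
    rw [h2] at h6
    have h7 : ‖η‖ = 0 := by
      have := norm_nonneg η
      nlinarith
    simpa using h7
  -- Hence `r` sits under `E(t, ∞)`, where `φ` is at least `φ t`, and Markov's inequality finishes.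
  have hle : r.1 ≤ E.proj (Set.Ioi t) := by
    refine r.isStarProjection_op.le_of_mul_eq_left
      (isStarProjection_coe (E.isStarProjection _ measurableSet_Ioi)) ?_
    rw [← Set.compl_Iic, E.proj_compl measurableSet_Iic]
    change r.op * (1 - e) = r.op
    rw [mul_sub, hzero, mul_one, sub_zero]
  have h1 := τ.val_mono hle
  have hφt : 0 ≤ φ t := by
    obtain ⟨g, -, -, -, hg⟩ := hφ.exists_density
    have := hφ.monotone le_rfl t.2
    rwa [hg 0 le_rfl, intervalIntegral.integral_same] at this
  have h2 : ENNReal.ofReal (φ t * τ.val (E.proj (Set.Ioi t))) ≤ 1 := by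
    refine le_trans ?_ hint
    rw [ENNReal.ofReal_mul hφt, ← τ.spectralDistribution_apply E measurableSet_Ioi]
    refine le_trans ?_ (mul_meas_ge_le_lintegral₀ ?_ (ENNReal.ofReal (φ t)))
    · gcongr
      intro s hs
      exact ENNReal.ofReal_le_ofReal (hφ.monotone t.2 (by exact_mod_cast (Set.mem_Ioi.1 hs).le))
    · have hmono : Monotone fun s : ℝ≥0 => ENNReal.ofReal (φ s) := fun a b hab =>
        ENNReal.ofReal_le_ofReal (hφ.monotone a.2 (by exact_mod_cast hab))
      exact hmono.measurable.aemeasurable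
  rw [ENNReal.ofReal_le_one] at h2
  exact (mul_le_mul_of_nonneg_left h1 hφt).trans h2

/-! ### Strong operations on graphs and cuts -/

@[simp] theorem mem_graph_ofCLM {a : H →L[ℂ] H} {ξ η : H} :
    (ξ, η) ∈ (ofCLM a).graph ↔ a ξ = η := by
  rw [LinearPMap.mem_graph_iff]
  constructor
  · rintro ⟨y, h1, h2⟩
    change a y = η at h2
    rwa [h1] at h2
  · intro h
    exact ⟨⟨ξ, trivial⟩, rfl, h⟩

theorem isClosed_ofCLM (a : H →L[ℂ] H) : (ofCLM a).IsClosed := by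
  have : ((ofCLM a).graph : Set (H × H)) = {p | a p.1 = p.2} := by
    ext ⟨ξ, η⟩
    exact mem_graph_ofCLM
  rw [LinearPMap.IsClosed, this]
  exact isClosed_eq (a.continuous.comp continuous_fst) continuous_snd

theorem ofCLM_injective : Function.Injective (ofCLM (H := H)) := by
  intro a b h
  ext ξ
  have h1 : (ξ, a ξ) ∈ (ofCLM b).graph := h ▸ mem_graph_ofCLM.2 rfl
  exact (mem_graph_ofCLM.1 h1).symm

theorem eq_ofCLM {T : H →ₗ.[ℂ] H} {a : H →L[ℂ] H} (h : ∀ ξ, (ξ, a ξ) ∈ T.graph) : T = ofCLM a := by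
  apply LinearPMap.eq_of_eq_graph
  ext ⟨ξ, η⟩
  rw [mem_graph_ofCLM]
  constructor
  · exact fun h1 => T.mem_graph_snd_inj (h ξ) h1 rfl
  · rintro rfl
    exact h ξ

theorem smul_ofCLM (c : ℂ) (a : H →L[ℂ] H) : c • ofCLM a = ofCLM (c • a) :=
  eq_ofCLM fun ξ => LinearPMap.mem_graph_iff _ |>.2 ⟨⟨ξ, trivial⟩, rfl, rfl⟩

theorem mem_graph_opMul {x y : H →ₗ.[ℂ] H} {ξ ζ : H} :
    (ξ, ζ) ∈ (opMul x y).graph ↔ ∃ η, (ξ, η) ∈ y.graph ∧ (η, ζ) ∈ x.graph := by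
  constructor
  · intro h
    obtain ⟨⟨v, hv⟩, rfl, rfl⟩ := (LinearPMap.mem_graph_iff _).1 h
    obtain ⟨w, hw, hwv⟩ := hv.1
    refine ⟨y w, (LinearPMap.mem_graph_iff _).2 ⟨w, hwv, rfl⟩,
      (LinearPMap.mem_graph_iff _).2 ⟨⟨y w, hw⟩, rfl, ?_⟩⟩
    change x _ = x _
    congr 1
    apply Subtype.ext
    exact (LinearPMap.domRestrict_apply (f := y) (x := ⟨v, hv⟩) (y := w) hwv.symm).symm
  · rintro ⟨η, h1, h2⟩
    obtain ⟨v, rfl, rfl⟩ := (LinearPMap.mem_graph_iff _).1 h1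
    obtain ⟨w, hw, rfl⟩ := (LinearPMap.mem_graph_iff _).1 h2
    have hd : (v : H) ∈ mulDomain x y := by
      refine ⟨v, ?_, rfl⟩
      change y v ∈ x.domain
      have : (w : H) = y v := hw
      rw [← this]
      exact w.2
    refine (LinearPMap.mem_graph_iff _).2 ⟨⟨v, hd, v.2⟩, rfl, ?_⟩
    change x _ = x _
    congr 1
    apply Subtype.ext
    rw [hw]
    exact LinearPMap.domRestrict_apply (f := y) (x := ⟨v, hd, v.2⟩) (y := v) rfl

theorem mem_graph_add {x y : H →ₗ.[ℂ] H} {ξ η ζ : H} (h1 : (ξ, η) ∈ x.graph)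
    (h2 : (ξ, ζ) ∈ y.graph) : (ξ, η + ζ) ∈ (x + y).graph := by
  obtain ⟨v, rfl, rfl⟩ := (LinearPMap.mem_graph_iff _).1 h1
  obtain ⟨w, hw, rfl⟩ := (LinearPMap.mem_graph_iff _).1 h2
  refine (LinearPMap.mem_graph_iff _).2 ⟨⟨v, v.2, ?_⟩, rfl, ?_⟩
  · have : (w : H) = v := hw
    rw [← this]
    exact w.2
  · rw [LinearPMap.add_apply]
    congr 2
    exact Subtype.ext hw.symm

theorem Cut.strongAdd {S T : H →ₗ.[ℂ] H} {e b c : H →L[ℂ] H} (hb : Cut S e b) (hc : Cut T e c) :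
    Cut (strongAdd S T) e (b + c) :=
  Cut.mono (fun ξ => mem_graph_add (hb ξ) (hc ξ)) (LinearPMap.le_closure _)

theorem Cut.ofCLM_strongMul {T : H →ₗ.[ℂ] H} {e b : H →L[ℂ] H} (hb : Cut T e b)
    (a : H →L[ℂ] H) : Cut (strongMul (ofCLM a) T) e (a * b) :=
  Cut.mono (fun ξ => mem_graph_opMul.2 ⟨b ξ, hb ξ, mem_graph_ofCLM.2 rfl⟩)
    (LinearPMap.le_closure _)

theorem Cut.strongMul_ofCLM {T : H →ₗ.[ℂ] H} {e b : H →L[ℂ] H} (hb : Cut T e b)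
    {a : H →L[ℂ] H} (ha : a * e = e * a) : Cut (strongMul T (ofCLM a)) e (b * a) :=
  Cut.mono (fun ξ => mem_graph_opMul.2 ⟨a (e ξ), mem_graph_ofCLM.2 rfl, by
    have : a (e ξ) = e (a ξ) := congrArg (fun T : H →L[ℂ] H => T ξ) ha
    rw [this]
    exact hb (a ξ)⟩) (LinearPMap.le_closure _)

theorem cut_ofCLM (a e : H →L[ℂ] H) : Cut (ofCLM a) e (a * e) := fun _ => mem_graph_ofCLM.2 rfl

theorem Cut.eq_ofCLM {T : H →ₗ.[ℂ] H} {a : H →L[ℂ] H} (h : Cut T 1 a) : T = ofCLM a :=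
  GenArens.eq_ofCLM h

theorem strongAdd_ofCLM (a b : H →L[ℂ] H) : strongAdd (ofCLM a) (ofCLM b) = ofCLM (a + b) := by
  have := (cut_ofCLM a 1).strongAdd (cut_ofCLM b 1)
  rw [mul_one, mul_one] at this
  exact this.eq_ofCLM

theorem strongMul_ofCLM_ofCLM (a b : H →L[ℂ] H) :
    strongMul (ofCLM a) (ofCLM b) = ofCLM (a * b) := by
  have := (cut_ofCLM b 1).ofCLM_strongMul a
  rw [mul_one] at this
  exact this.eq_ofCLM

/-- The unclosed product is the restriction of `b` to the dense domain of `T`, and the closure of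
such a restriction is `b`. -/
theorem ofCLM_strongMul_eq_ofCLM {T : H →ₗ.[ℂ] H} (hT : Dense (T.domain : Set H))
    {a b : H →L[ℂ] H} (h : ∀ ξ η, (ξ, η) ∈ T.graph → a η = b ξ) :
    strongMul (ofCLM a) T = ofCLM b := by
  have hle : opMul (ofCLM a) T ≤ ofCLM b := by
    refine LinearPMap.le_of_le_graph ?_
    rintro ⟨ξ, ζ⟩ h1
    obtain ⟨η, h2, h3⟩ := mem_graph_opMul.1 h1
    rw [mem_graph_ofCLM] at h3 ⊢
    rw [← h3, h _ _ h2]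
  have hc := (isClosed_ofCLM b).isClosable.leIsClosable hle
  refine eq_ofCLM fun ξ => ?_
  rw [strongMul, ← hc.graph_closure_eq_closure_graph]
  change (ξ, b ξ) ∈ closure ((opMul (ofCLM a) T).graph : Set (H × H))
  have hcont : Continuous fun ζ : H => (ζ, b ζ) := by fun_prop
  have h1 : ξ ∈ closure (T.domain : Set H) := hT ξ
  refine closure_mono ?_ (image_closure_subset_closure_image hcont ⟨ξ, h1, rfl⟩)
  rintro _ ⟨v, hv, rfl⟩
  exact mem_graph_opMul.2 ⟨T ⟨v, hv⟩, T.mem_graph ⟨v, hv⟩,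
    mem_graph_ofCLM.2 (h _ _ (T.mem_graph ⟨v, hv⟩))⟩

theorem Cut.apply_eq {T : H →ₗ.[ℂ] H} (hM : ∀ a ∈ M, ∀ b ∈ M, a * b = b * a)
    (hT : Affiliated M T) {e : Proj M} {b : H →L[ℂ] H} (hb : Cut T e.op b) {ξ η : H}
    (h : (ξ, η) ∈ T.graph) : e.op η = b ξ :=
  T.mem_graph_snd_inj (hT.proj_mem_graph hM e h) (hb ξ) rfl

/-- A measurable operator is determined by its cuts along projections tending to `1`. -/
theorem eq_of_cut {S T : H →ₗ.[ℂ] H} (hM : ∀ a ∈ M, ∀ b ∈ M, a * b = b * a)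
    (hS : S.IsClosed) (hT : T.IsClosed) (hSa : Affiliated M S) (hTa : Affiliated M T)
    {e : ℕ → Proj M} (he : ∀ ξ, Filter.Tendsto (fun n => (e n).op ξ) Filter.atTop (nhds ξ))
    {b : ℕ → H →L[ℂ] H} (hSb : ∀ n, Cut S (e n).op (b n)) (hTb : ∀ n, Cut T (e n).op (b n)) :
    S = T := by
  have key : ∀ S T : H →ₗ.[ℂ] H, T.IsClosed → Affiliated M S → (∀ n, Cut S (e n).op (b n)) →
      (∀ n, Cut T (e n).op (b n)) → S.graph ≤ T.graph := by
    rintro S T hT hS hSb hTb ⟨ξ, η⟩ h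
    -- The points `(e_n ξ, e_n η) = (e_n ξ, b_n ξ)` lie in the closed graph of `T` and tend to `(ξ,
    -- η)`.
    refine hT.mem_of_tendsto ((he ξ).prodMk_nhds (he η)) (.of_forall fun n => ?_)
    rw [(hSb n).apply_eq hM hS h]
    exact hTb n ξ
  exact LinearPMap.eq_of_eq_graph
    (le_antisymm (key S T hT hSa hSb hTb) (key T S hS hTa hTb hSb))

/-! ### Consequences of the spectral theorem -/

/-- The measure is that of `|a|`, which commutes with `M'` and so lies in `M`; its second moment is
`⟨|a|²ξ, ξ⟩ = ‖aξ‖²`. -/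
theorem exists_modulus {a : H →L[ℂ] H} (ha : a ∈ M) :
    ∃ E : PVM M, E.proj (Set.Iic ‖a‖₊) = 1 ∧ IsModulusSpectralMeasure (ofCLM a) E := by
  have hm : CFC.abs a ∈ M := by
    refine mem_of_forall_commute fun u hu => ?_
    exact Commute.cfcAbs_right (commute_of_mem_commutant ha hu)
      (commute_of_mem_commutant ha (star_mem hu))
  obtain ⟨E, hE1, hE⟩ := exists_pvm hm (CFC.abs_nonneg a)
  have hn : ‖CFC.abs a‖₊ = ‖a‖₊ := by
    apply NNReal.eq
    simp
  rw [hn] at hE1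
  have hfin : ∀ ξ, ∫⁻ t, (t : ℝ≥0∞) ^ 2 ∂(E.scalarMeasure ξ) < ∞ := by
    intro ξ
    have h1 := E.lintegral_scalarMeasure_le (ξ := ξ) (measurableSet_Iic (a := ‖a‖₊))
      (by rw [hE1]; rfl) (f := fun t => (t : ℝ≥0∞) ^ 2)
      (c := (‖a‖₊ : ℝ≥0∞) ^ 2) fun t ht => pow_le_pow_left' (by exact_mod_cast ht) 2
    exact h1.trans_lt (ENNReal.mul_lt_top (ENNReal.pow_lt_top ENNReal.coe_lt_top)
      ENNReal.ofReal_lt_top)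
  refine ⟨E, hE1, fun ξ => ⟨fun _ => hfin ξ, fun _ => trivial⟩, fun ξ => ?_⟩
  have h1 := hE (fun t => t ^ 2) (by fun_prop) ξ
  have hsa : IsSelfAdjoint (CFC.abs a) := (CFC.abs_nonneg a).isSelfAdjoint
  rw [cfc_pow_id (CFC.abs a) 2, sq, CFC.abs_mul_abs, mul_apply_eq_comp,
    ContinuousLinearMap.star_eq_adjoint, ContinuousLinearMap.adjoint_inner_left,
    inner_self_eq_norm_sq_to_K] at h1
  have h2 : ‖a ξ‖ ^ 2 = ∫ t : ℝ≥0, (t : ℝ) ^ 2 ∂(E.scalarMeasure ξ) := by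
    rw [← h1]; norm_cast
  change ENNReal.ofReal (‖a ξ‖ ^ 2) = _
  have h3 : ∀ t : ℝ≥0, ENNReal.ofReal ((t : ℝ) ^ 2) = (t : ℝ≥0∞) ^ 2 := fun t => by
    rw [ENNReal.ofReal_pow (NNReal.coe_nonneg t), ENNReal.ofReal_coe_nnreal]
  rw [h2, integral_eq_lintegral_of_nonneg_ae (.of_forall fun t => sq_nonneg _) (by fun_prop)]
  simp only [h3]
  exact ENNReal.ofReal_toReal (hfin ξ).ne

theorem ofCLM_mem_measurableOps (τ : FiniteTrace M) {a : H →L[ℂ] H} (ha : a ∈ M) :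
    ofCLM a ∈ measurableOps τ := by
  refine ⟨isClosed_ofCLM a, fun u hu _ ξ => ⟨trivial, ?_⟩, fun ε hε =>
    ⟨Proj.mk 1 (one_mem M) (.one _), fun _ => trivial, ?_⟩⟩
  · exact congrArg (fun T : H →L[ℂ] H => T ξ) (commute_of_mem_commutant ha hu).eq.symm
  · have : (1 - (Proj.mk (M := M) 1 (one_mem M) (.one _)).1 : M.toStarSubalgebra) = 0 :=
      sub_self _
    rw [this]
    simpa [FiniteTrace.val] using hε

theorem ofCLM_mem_orliczSpace (τ : FiniteTrace M) {φ : ℝ → ℝ} (hφ : IsYoung φ) {a : H →L[ℂ] H}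
    (ha : a ∈ M) : ofCLM a ∈ orliczSpace τ φ := by
  have hτ : 0 ≤ τ.val 1 := τ.val_nonneg (nonneg_of_isStarProjection (.one _))
  -- After scaling `a` to norm at most `d`, the integral of `φ` is at most `φ(d) τ(1) ≤ 1`; the `+
  -- 1` keeps the denominator positive when `τ(1) = 0`.
  obtain ⟨d, hd, hφd⟩ := hφ.exists_le (ε := 1 / (τ.val 1 + 1)) (by positivity)
  obtain ⟨n, hn⟩ := exists_nat_ge (max 1 (‖a‖ / d))
  have hn1 : (1 : ℝ) ≤ n := (le_max_left _ _).trans hn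
  have hn0 : (0 : ℝ) < n := one_pos.trans_le hn1
  have hm : (n : ℂ)⁻¹ • a ∈ M := M.toStarSubalgebra.smul_mem ha _
  have hnorm : ‖(n : ℂ)⁻¹ • a‖ ≤ d := by
    rw [norm_smul, norm_inv, Complex.norm_natCast, inv_mul_le_iff₀ hn0, ← div_le_iff₀ hd]
    exact (le_max_right _ _).trans hn
  obtain ⟨E, hE1, hE⟩ := exists_modulus hm
  refine ⟨n, by exact_mod_cast hn1, ofCLM ((n : ℂ)⁻¹ • a),
    ⟨ofCLM_mem_measurableOps τ hm, E, hE, ?_⟩, ?_⟩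
  · have h0 : τ.spectralDistribution E (Set.Iic ‖(n : ℂ)⁻¹ • a‖₊)ᶜ = 0 := by
      rw [τ.spectralDistribution_apply E measurableSet_Iic.compl, E.proj_compl measurableSet_Iic,
        hE1, sub_self]
      simp [FiniteTrace.val]
    have h1 : ∫⁻ t, ENNReal.ofReal (φ t) ∂(τ.spectralDistribution E)
        ≤ ∫⁻ _, ENNReal.ofReal (φ d) ∂(τ.spectralDistribution E) := by
      refine lintegral_mono_ae ?_
      rw [ae_iff]
      refine measure_mono_null (fun t ht => ?_) h0
      refine fun hmem => ht ?_
      refine ENNReal.ofReal_le_ofReal (hφ.monotone t.2 (le_trans ?_ hnorm))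
      exact_mod_cast hmem
    refine h1.trans ?_
    rw [lintegral_const, τ.spectralDistribution_apply E MeasurableSet.univ, E.univ,
      ← ENNReal.ofReal_mul' hτ, ENNReal.ofReal_le_one]
    calc φ d * τ.val 1 ≤ 1 / (τ.val 1 + 1) * τ.val 1 := by gcongr
      _ ≤ 1 := by
        rw [one_div, inv_mul_le_iff₀ (by positivity)]
        linarith
  · rw [smul_ofCLM, smul_smul, mul_inv_cancel₀ (by exact_mod_cast hn0.ne'), one_smul]

theorem ofCLM_mem_arensAlgebra (τ : FiniteTrace M) {Λ : Set (ℝ → ℝ)} (hΛ : IsQuadraticFamily Λ)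
    {a : H →L[ℂ] H} (ha : a ∈ M) : ofCLM a ∈ arensAlgebra τ Λ :=
  ⟨ofCLM_mem_measurableOps τ ha, fun φ hφ => ofCLM_mem_orliczSpace τ (hΛ.young φ hφ) ha⟩

/-- A nonzero element is bounded below on the range of a nonzero projection. -/
theorem exists_proj_bddBelow {a : H →L[ℂ] H} (ha : a ∈ M) (h0 : a ≠ 0) :
    ∃ (r : Proj M) (ε : ℝ), r.op ≠ 0 ∧ 0 < ε ∧ ∀ ξ, ε * ‖r.op ξ‖ ≤ ‖a (r.op ξ)‖ := by
  obtain ⟨E, -, hE⟩ := exists_modulus ha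
  -- Otherwise every scalar measure is concentrated at 0 and `a = 0`.
  have hex : ∃ n : ℕ, E.proj (Set.Iic (1 / ((n : ℝ≥0) + 1)))ᶜ ≠ 0 := by
    by_contra hcon
    push Not at hcon
    refine h0 ?_
    ext ξ
    have h1 : E.scalarMeasure ξ {t | ¬ t = 0} = 0 := by
      have : {t : ℝ≥0 | ¬ t = 0} ⊆ ⋃ n : ℕ, (Set.Iic (1 / ((n : ℝ≥0) + 1)))ᶜ := by
        intro t ht
        obtain ⟨n, hn⟩ := exists_nat_one_div_lt (pos_iff_ne_zero.2 ht)
        exact Set.mem_iUnion.2 ⟨n, not_le.2 hn⟩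
      refine measure_mono_null this (measure_iUnion_null fun n => ?_)
      rw [E.scalarMeasure_apply ξ measurableSet_Iic.compl, hcon n]
      simp
    have h2 := hE.2 ⟨ξ, trivial⟩
    have h3 : ∫⁻ t, (t : ℝ≥0∞) ^ 2 ∂(E.scalarMeasure ξ) = 0 := by
      rw [lintegral_eq_zero_iff (by fun_prop)]
      filter_upwards [ae_iff.2 h1] with t ht
      simp [ht]
    rw [h3] at h2
    have h4 : ‖a ξ‖ ^ 2 ≤ 0 := ENNReal.ofReal_eq_zero.1 h2
    have h5 : ‖a ξ‖ = 0 := pow_eq_zero_iff two_ne_zero |>.1 (le_antisymm h4 (sq_nonneg _))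
    simpa using h5
  obtain ⟨n, hn⟩ := hex
  set c : ℝ≥0 := 1 / ((n : ℝ≥0) + 1) with hc
  have hc0 : 0 < c := by positivity
  refine ⟨E.toProj (Set.Iic c)ᶜ measurableSet_Iic.compl, c, fun h => hn (Subtype.ext h), hc0,
    fun ξ => ?_⟩
  set r := E.toProj (Set.Iic c)ᶜ measurableSet_Iic.compl with hr
  have h1 := hE.2 ⟨r.op ξ, trivial⟩
  have h2 : E.scalarMeasure (r.op ξ) (Set.Iic c)ᶜᶜ = 0 :=
    E.scalarMeasure_compl_eq_zero measurableSet_Iic.compl (r.op_op_apply ξ)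
  have h3 : ∫⁻ _, ((c : ℝ≥0∞)) ^ 2 ∂(E.scalarMeasure (r.op ξ))
      ≤ ∫⁻ t, (t : ℝ≥0∞) ^ 2 ∂(E.scalarMeasure (r.op ξ)) := by
    refine lintegral_mono_ae ?_
    rw [ae_iff]
    refine measure_mono_null (fun t ht => ?_) h2
    refine fun hmem => ht ?_
    have hct : c < t := by simpa using hmem
    exact pow_le_pow_left' (by exact_mod_cast hct.le) 2
  rw [← h1, lintegral_const, E.scalarMeasure_univ] at h3
  have h4 : (c : ℝ≥0∞) ^ 2 * ENNReal.ofReal (‖r.op ξ‖ ^ 2)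
      = ENNReal.ofReal ((c * ‖r.op ξ‖) ^ 2) := by
    rw [mul_pow, ENNReal.ofReal_mul (by positivity), ENNReal.ofReal_pow (NNReal.coe_nonneg c),
      ENNReal.ofReal_coe_nnreal]
  rw [h4, ENNReal.ofReal_le_ofReal_iff (by positivity)] at h3
  exact le_of_sq_le_sq h3 (norm_nonneg _)

/-! ### Approximation by Gaussian integer combinations of projections -/

/-- `‖(h - k)ξ‖²` is the integral of `(t - k)²` against a measure carried by `B`, where the
integrand is at most 1. -/
theorem norm_sub_smul_le_of_spectral {h : H →L[ℂ] H} (hh : IsSelfAdjoint h) {E : PVM M}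
    (hE : ∀ (f : ℝ → ℝ), Continuous f → ∀ ξ : H,
      (inner ℂ (cfc f h ξ) ξ).re = ∫ t, f t ∂(E.scalarMeasure ξ))
    {B : Set ℝ≥0} (hB : MeasurableSet B) {k : ℝ} (hk : ∀ t ∈ B, |(t : ℝ) - k| ≤ 1) {ξ : H}
    (hξ : (E.proj B : H →L[ℂ] H) ξ = ξ) : ‖h ξ - (k : ℂ) • ξ‖ ≤ ‖ξ‖ := by
  have h1 := hE (fun t => (t - k) ^ 2) (by fun_prop) ξ
  have h2 : cfc (fun t : ℝ => (t - k) ^ 2) h = (h - (k : ℂ) • 1) * (h - (k : ℂ) • 1) := by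
    rw [cfc_pow (fun t : ℝ => t - k) 2 h, cfc_sub (fun t : ℝ => t) (fun _ => k) h, cfc_id' ℝ h,
      cfc_const k h, sq, Algebra.algebraMap_eq_smul_one]
    rfl
  have h3 : ContinuousLinearMap.adjoint (h - (k : ℂ) • (1 : H →L[ℂ] H)) = h - (k : ℂ) • 1 := by
    rw [← ContinuousLinearMap.star_eq_adjoint, star_sub, hh.star_eq, star_smul, star_one]
    simp
  have h4 : (h - (k : ℂ) • (1 : H →L[ℂ] H)) ξ = h ξ - (k : ℂ) • ξ := rfl
  have h5 : ‖h ξ - (k : ℂ) • ξ‖ ^ 2 = ∫ t : ℝ≥0, ((t : ℝ) - k) ^ 2 ∂(E.scalarMeasure ξ) := by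
    rw [← h1, h2, mul_apply_eq_comp]
    conv_rhs => rw [← h3]
    rw [ContinuousLinearMap.adjoint_inner_left, h3, h4, inner_self_eq_norm_sq_to_K]
    norm_cast
  have h6 : ∫ t : ℝ≥0, ((t : ℝ) - k) ^ 2 ∂(E.scalarMeasure ξ)
      ≤ ∫ _ : ℝ≥0, (1 : ℝ) ∂(E.scalarMeasure ξ) := by
    refine integral_mono_of_nonneg (.of_forall fun t => sq_nonneg _) (integrable_const _) ?_
    rw [Filter.EventuallyLE, ae_iff]
    refine measure_mono_null (fun t ht => ?_) (E.scalarMeasure_compl_eq_zero hB hξ)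
    refine fun hmem => ht ?_
    have := hk t hmem
    rw [← sq_abs]
    exact pow_le_one₀ (abs_nonneg _) this
  rw [← h5, integral_const, smul_eq_mul, mul_one, Measure.real, E.scalarMeasure_univ,
    ENNReal.toReal_ofReal (sq_nonneg _)] at h6
  exact le_of_sq_le_sq h6 (norm_nonneg _)

theorem opNorm_le_of_partition {ι : Type*} {s : Finset ι} {P : ι → H →L[ℂ] H}
    (hP : ∀ i ∈ s, IsStarProjection (P i)) (horth : ∀ i ∈ s, ∀ j ∈ s, i ≠ j → P i * P j = 0)
    (hsum : ∑ i ∈ s, P i = 1) {T : H →L[ℂ] H} (hT : ∀ i ∈ s, P i * T = T * P i) {c : ℝ}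
    (hc : 0 ≤ c) (h : ∀ i ∈ s, ∀ ξ, ‖T (P i ξ)‖ ≤ c * ‖P i ξ‖) : ‖T‖ ≤ c := by
  have key : ∀ ξ : H, ‖ξ‖ ^ 2 = ∑ i ∈ s, ‖P i ξ‖ ^ 2 := by
    intro ξ
    rw [← norm_sum_sq_of_inner_eq_zero s (fun i => P i ξ) fun i hi j hj hij =>
      inner_apply_apply_eq_zero (hP i hi) (horth i hi j hj hij) _ _, ← sum_apply, hsum,
      one_apply_eq_self]
  refine T.opNorm_le_bound hc fun ξ => ?_
  have h1 : ‖T ξ‖ ^ 2 ≤ (c * ‖ξ‖) ^ 2 := by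
    rw [key (T ξ), mul_pow, key ξ, Finset.mul_sum]
    refine Finset.sum_le_sum fun i hi => ?_
    have h2 : P i (T ξ) = T (P i ξ) := congrArg (fun A : H →L[ℂ] H => A ξ) (hT i hi)
    rw [h2, ← mul_pow]
    exact pow_le_pow_left₀ (norm_nonneg _) (h i hi ξ) 2
  exact le_of_sq_le_sq h1 (by positivity)

theorem PVM.sum_proj_Ico (E : PVM M) (n : ℕ) :
    ∑ k ∈ Finset.range n, E.proj (Set.Ico (k : ℝ≥0) (k + 1)) = E.proj (Set.Iio (n : ℝ≥0)) := by
  induction n with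
  | zero =>
    have : Set.Iio ((0 : ℕ) : ℝ≥0) = ∅ := by ext t; simp
    rw [this, E.proj_empty, Finset.range_zero, Finset.sum_empty]
  | succ n ih =>
    rw [Finset.sum_range_succ, ih, ← E.proj_union measurableSet_Iio measurableSet_Ico]
    · congr 1
      rw [Set.Iio_union_Ico_eq_Iio (by simp)]
      simp
    · exact Set.disjoint_left.2 fun t h1 h2 => absurd h2.1 (not_le.2 h1)

/-- Round the spectrum down to integers: `s = ∑ k E[k, k+1)` is off by at most 1 on each spectral
piece. -/
theorem exists_approx_of_nonneg (hM : ∀ a ∈ M, ∀ b ∈ M, a * b = b * a) {h : H →L[ℂ] H}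
    (hm : h ∈ M) (h0 : 0 ≤ h) :
    ∃ s ∈ AddSubgroup.closure (Set.range (Proj.op (M := M))), ‖h - s‖ ≤ 1 := by
  obtain ⟨E, hE1, hE⟩ := exists_pvm hm h0
  obtain ⟨n, hn⟩ := exists_nat_gt ‖h‖₊
  have hms : ∀ k : ℕ, MeasurableSet (Set.Ico (k : ℝ≥0) (k + 1)) := fun k => measurableSet_Ico
  let Q : ℕ → Proj M := fun k => E.toProj (Set.Ico (k : ℝ≥0) (k + 1)) (hms k)
  have horth : ∀ i ∈ Finset.range n, ∀ j ∈ Finset.range n, i ≠ j → (Q i).op * (Q j).op = 0 := by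
    intro i _ j _ hij
    refine congrArg Subtype.val (E.mul_eq_zero (hms i) (hms j) ?_)
    refine Set.disjoint_left.2 fun t h1 h2 => hij ?_
    have e1 : (i : ℝ≥0) < j + 1 := h1.1.trans_lt h2.2
    have e2 : (j : ℝ≥0) < i + 1 := h2.1.trans_lt h1.2
    have e3 : i < j + 1 := by exact_mod_cast e1
    have e4 : j < i + 1 := by exact_mod_cast e2
    omega
  have hsum : ∑ k ∈ Finset.range n, (Q k).op = 1 := by
    have h1 := congrArg M.toStarSubalgebra.subtype (E.sum_proj_Ico n)
    have h2 : E.proj (Set.Iio (n : ℝ≥0)) = 1 := by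
      have e1 : Set.Iio (n : ℝ≥0) = Set.Iic ‖h‖₊ ∪ Set.Ioo ‖h‖₊ n := by
        rw [Set.Iic_union_Ioo_eq_Iio hn]
      have e2 : E.proj (Set.Ioo ‖h‖₊ n) = 0 := by
        have := E.mul_eq_zero (B := Set.Iic ‖h‖₊) (C := Set.Ioo ‖h‖₊ n) measurableSet_Iic
          measurableSet_Ioo (Set.disjoint_left.2 fun t h1 h2 => absurd h2.1 (not_lt.2 h1))
        rwa [hE1, one_mul] at this
      rw [e1, E.proj_union measurableSet_Iic measurableSet_Ioo
        (Set.disjoint_left.2 fun t h1 h2 => absurd h2.1 (not_lt.2 h1)), e2, hE1, add_zero]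
    rw [h2, map_sum] at h1
    exact h1
  set s : H →L[ℂ] H := ∑ k ∈ Finset.range n, k • (Q k).op with hs
  have hsm : s ∈ M := sum_mem fun k _ => nsmul_mem (Q k).op_mem k
  refine ⟨s, sum_mem fun k _ => nsmul_mem (AddSubgroup.subset_closure (Set.mem_range_self (Q k))) k, ?_⟩
  refine opNorm_le_of_partition (s := Finset.range n) (P := fun k => (Q k).op)
    (fun k _ => (Q k).isStarProjection_op) horth hsum
    (fun k _ => hM _ (Q k).op_mem _ (sub_mem hm hsm)) zero_le_one fun k hk ξ => ?_
  have h1 : s * (Q k).op = k • (Q k).op := by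
    rw [hs, Finset.sum_mul, Finset.sum_eq_single k]
    · rw [smul_mul_assoc, (Q k).op_op]
    · intro j hj hjk
      rw [smul_mul_assoc, horth j hj k hk hjk, smul_zero]
    · exact fun h => absurd hk h
  have h2 : (h - s) ((Q k).op ξ) = h ((Q k).op ξ) - ((k : ℝ) : ℂ) • (Q k).op ξ := by
    rw [sub_apply]
    congr 1
    rw [← mul_apply_eq_comp, h1]
    simp [← Nat.cast_smul_eq_nsmul ℂ]
  rw [h2, one_mul]
  refine norm_sub_smul_le_of_spectral h0.isSelfAdjoint hE (hms k) (fun t ht => ?_)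
    ((Q k).op_op_apply ξ)
  have e1 : (k : ℝ) ≤ t := by exact_mod_cast ht.1
  have e2 : (t : ℝ) < k + 1 := by exact_mod_cast ht.2
  rw [abs_le]
  constructor <;> linarith

/-- Shift by an integer multiple of the projection 1 to reach the positive case. -/
theorem exists_approx_of_isSelfAdjoint (hM : ∀ a ∈ M, ∀ b ∈ M, a * b = b * a) {h : H →L[ℂ] H}
    (hm : h ∈ M) (hh : IsSelfAdjoint h) :
    ∃ s ∈ AddSubgroup.closure (Set.range (Proj.op (M := M))), ‖h - s‖ ≤ 1 := by
  obtain ⟨n, hn⟩ := exists_nat_ge ‖h‖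
  have h1 : 0 ≤ h + n • (1 : H →L[ℂ] H) := by
    have e1 := hh.neg_algebraMap_norm_le_self
    have e2 : algebraMap ℝ (H →L[ℂ] H) ‖h‖ ≤ algebraMap ℝ (H →L[ℂ] H) n :=
      algebraMap_mono _ hn
    have e3 : n • (1 : H →L[ℂ] H) = algebraMap ℝ (H →L[ℂ] H) n := by simp
    rw [e3]
    have e4 : -algebraMap ℝ (H →L[ℂ] H) n ≤ h := (neg_le_neg e2).trans e1
    exact neg_le_iff_add_nonneg.1 e4
  obtain ⟨s, hs, hs1⟩ := exists_approx_of_nonneg hM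
    (add_mem hm (nsmul_mem (one_mem M) n)) h1
  refine ⟨s - n • (1 : H →L[ℂ] H), sub_mem hs (nsmul_mem (AddSubgroup.subset_closure
    (Set.mem_range_self (Proj.mk 1 (one_mem M) (.one _)))) n), ?_⟩
  rwa [← sub_add, sub_add_eq_add_sub]

/-- The real and imaginary parts cost an error of 1 each. What matters later is that the bound does
not depend on `a`. -/
theorem exists_approx (hM : ∀ a ∈ M, ∀ b ∈ M, a * b = b * a) {a : H →L[ℂ] H} (ha : a ∈ M) :
    ∃ s ∈ AddSubgroup.closure (Set.range (Proj.op (M := M))),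
      ∃ t ∈ AddSubgroup.closure (Set.range (Proj.op (M := M))),
        ‖a - (s + Complex.I • t)‖ ≤ 2 := by
  have hr : (realPart a : H →L[ℂ] H) ∈ M := by
    rw [realPart_apply_coe, ← Complex.coe_smul]
    exact M.toStarSubalgebra.smul_mem (add_mem ha (star_mem ha)) _
  have hi : (imaginaryPart a : H →L[ℂ] H) ∈ M := by
    rw [imaginaryPart_apply_coe, ← Complex.coe_smul]
    exact M.toStarSubalgebra.smul_mem (M.toStarSubalgebra.smul_mem (sub_mem ha (star_mem ha)) _) _
  obtain ⟨s, hs, hs1⟩ := exists_approx_of_isSelfAdjoint hM hr (realPart a).2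
  obtain ⟨t, ht, ht1⟩ := exists_approx_of_isSelfAdjoint hM hi (imaginaryPart a).2
  refine ⟨s, hs, t, ht, ?_⟩
  have h1 : a - (s + Complex.I • t) = ((realPart a : H →L[ℂ] H) - s)
      + Complex.I • ((imaginaryPart a : H →L[ℂ] H) - t) := by
    conv_lhs => rw [← realPart_add_I_smul_imaginaryPart a]
    rw [smul_sub]
    abel
  rw [h1]
  refine (norm_add_le _ _).trans ?_
  rw [norm_smul, Complex.norm_I, one_mul]
  linarith

theorem mem_of_mem_closure_range_op {s : H →L[ℂ] H}
    (hs : s ∈ AddSubgroup.closure (Set.range (Proj.op (M := M)))) : s ∈ M := by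
  induction hs using AddSubgroup.closure_induction with
  | mem x hx => obtain ⟨p, rfl⟩ := hx; exact p.op_mem
  | zero => exact zero_mem M
  | add x y _ _ h1 h2 => exact add_mem h1 h2
  | neg x _ h1 => exact neg_mem h1

/-- Bounded families can be glued along orthogonal projections. -/
theorem exists_glue (hM : ∀ a ∈ M, ∀ b ∈ M, a * b = b * a) {r : ℕ → Proj M}
    (hr : ∀ i j, i ≠ j → (r i).op * (r j).op = 0) {x : ℕ → H →L[ℂ] H} (hx : ∀ n, x n ∈ M) {C : ℝ}
    (hC : ∀ n, ‖x n‖ ≤ C) : ∃ a ∈ M, ∀ n, a * (r n).op = x n * (r n).op := by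
  have hC0 : 0 ≤ C := (norm_nonneg _).trans (hC 0)
  have hbessel : ∀ (s : Finset ℕ) ξ, ∑ n ∈ s, ‖(r n).op ξ‖ ^ 2 ≤ ‖ξ‖ ^ 2 := by
    intro s ξ
    have h1 : ∀ ξ, ‖(∑ n ∈ s, (r n).op) ξ‖ ^ 2 = ∑ n ∈ s, ‖(r n).op ξ‖ ^ 2 := fun ξ => by
      rw [sum_apply, norm_sum_sq_of_inner_eq_zero]
      exact fun i _ j _ hij =>
        inner_apply_apply_eq_zero (r i).isStarProjection_op (hr i j hij) _ _
    have h2 : IsStarProjection (∑ n ∈ s, (r n).op) := isStarProjection_of_norm_sq fun ξ => by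
      rw [h1, sum_apply, sum_inner, Complex.ofReal_sum]
      exact Finset.sum_congr rfl fun n _ =>
        inner_apply_self_of_isStarProjection (r n).isStarProjection_op ξ
    rw [← h1]
    exact pow_le_pow_left₀ (norm_nonneg _) (norm_apply_le_of_isStarProjection h2 ξ) 2
  let T : ℕ → H →L[ℂ] H := fun n => ∑ i ∈ Finset.range n, x i * (r i).op
  -- Bessel's inequality with the uniform bound `C`. Together with orthogonality of the terms it
  -- gives strong convergence of the partial sums `T n`.
  have hsum : ∀ ξ, Summable fun n => ‖(x n * (r n).op) ξ‖ ^ 2 := by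
    intro ξ
    refine .of_nonneg_of_le (fun n => sq_nonneg _) (fun n => ?_)
      ((summable_of_sum_le (fun n => sq_nonneg _) fun s => hbessel s ξ).mul_left (C ^ 2))
    rw [← mul_pow]
    refine pow_le_pow_left₀ (norm_nonneg _) ?_ 2
    exact ((x n).le_opNorm _).trans (mul_le_mul_of_nonneg_right (hC n) (norm_nonneg _))
  have hnorm : ∀ (s : Finset ℕ) ξ, ‖∑ n ∈ s, (x n * (r n).op) ξ‖ ^ 2
      = ∑ n ∈ s, ‖(x n * (r n).op) ξ‖ ^ 2 := by
    intro s ξ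
    refine norm_sum_sq_of_inner_eq_zero s _ fun i _ j _ hij => ?_
    rw [hM _ (hx i) _ (r i).op_mem, hM _ (hx j) _ (r j).op_mem]
    exact inner_apply_apply_eq_zero (r i).isStarProjection_op (hr i j hij) _ _
  have hc : ∀ ξ, CauchySeq fun n => T n ξ := by
    intro ξ
    refine cauchySeq_of_norm_sub_sq_le (hsum ξ).hasSum.tendsto_sum_nat.cauchySeq ?_
    have key : ∀ n m, m ≤ n → ‖T n ξ - T m ξ‖ ^ 2 = ∑ i ∈ Finset.range n, ‖(x i * (r i).op) ξ‖ ^ 2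
        - ∑ i ∈ Finset.range m, ‖(x i * (r i).op) ξ‖ ^ 2 := by
      intro n m hmn
      simp only [T, sum_apply]
      rw [← Finset.sum_Ico_eq_sub _ hmn, hnorm, Finset.sum_Ico_eq_sub _ hmn]
    intro n m
    rcases le_total m n with hmn | hmn
    · rw [key n m hmn]; exact le_abs_self _
    · rw [norm_sub_rev, key m n hmn, abs_sub_comm]; exact le_abs_self _
  choose f hf using fun ξ => cauchySeq_tendsto_of_complete (hc ξ)
  let A : H →L[ℂ] H := continuousLinearMapOfTendsto T (f := f) (tendsto_pi_nhds.2 hf)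
  have hA : ∀ ξ, Filter.Tendsto (fun n => T n ξ) Filter.atTop (nhds (A ξ)) := hf
  refine ⟨A, mem_of_forall_commute fun u hu => ?_, fun n => ?_⟩
  · ext ξ
    have h5 : Filter.Tendsto (fun n => u (T n ξ)) Filter.atTop (nhds (u (A ξ))) :=
      (u.continuous.tendsto _).comp (hA ξ)
    have h6 : (fun n => u (T n ξ)) = fun n => T n (u ξ) := by
      ext n
      have : Commute (T n) u := commute_of_mem_commutant
        (sum_mem fun i _ => mul_mem (hx i) (r i).op_mem) hu
      exact congrArg (fun A : H →L[ℂ] H => A ξ) this.eq.symm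
    rw [h6] at h5
    exact tendsto_nhds_unique h5 (hA (u ξ))
  · ext ξ
    refine tendsto_nhds_unique (hA ((r n).op ξ)) (tendsto_const_nhds.congr' ?_)
    filter_upwards [Filter.eventually_gt_atTop n] with m hm
    have : T m * (r n).op = x n * (r n).op := by
      simp only [T, Finset.sum_mul]
      rw [Finset.sum_eq_single n]
      · rw [mul_assoc, (r n).op_op]
      · intro j _ hjn
        rw [mul_assoc, hr j n hjn, mul_zero]
      · exact fun h => absurd (Finset.mem_range.2 hm) h
    exact congrArg (fun A : H →L[ℂ] H => A ξ) this.symm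

/-! ### Cuts of affiliated operators -/

theorem Cut.mem {T : H →ₗ.[ℂ] H} (hT : Affiliated M T) {e : Proj M} {b : H →L[ℂ] H}
    (hb : Cut T e.op b) : b ∈ M := by
  refine mem_of_forall_unitary_commute fun u hu hu' => ?_
  ext ξ
  have h2 : u (e.op ξ) = e.op (u ξ) := congrArg (fun T : H →L[ℂ] H => T ξ)
    (commute_of_mem_commutant e.op_mem hu).eq.symm
  exact T.mem_graph_snd_inj (hT.mem_graph hu hu' (hb ξ)) (hb (u ξ)) h2

theorem Cut.op_mul {T : H →ₗ.[ℂ] H} (hM : ∀ a ∈ M, ∀ b ∈ M, a * b = b * a)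
    (hT : Affiliated M T) {e : Proj M} {b : H →L[ℂ] H} (hb : Cut T e.op b) : e.op * b = b := by
  ext ξ
  rw [mul_apply_eq_comp, hb.apply_eq hM hT (hb ξ)]
  refine T.mem_graph_snd_inj (hb _) (hb ξ) ?_
  exact e.op_op_apply ξ

theorem Cut.mul_op {T : H →ₗ.[ℂ] H} {e : Proj M} {b : H →L[ℂ] H} (hb : Cut T e.op b) :
    b * e.op = b := by
  have h := hb.mul e.op
  rw [e.op_op] at h
  exact h.unique hb

/-- The product of two commuting projections. -/
def Proj.inter (hM : ∀ a ∈ M, ∀ b ∈ M, a * b = b * a) (p q : Proj M) : Proj M :=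
  Proj.mk (p.op * q.op) (mul_mem p.op_mem q.op_mem)
    (p.isStarProjection_op.mul q.isStarProjection_op (hM _ p.op_mem _ q.op_mem))

@[simp] theorem Proj.op_inter (hM : ∀ a ∈ M, ∀ b ∈ M, a * b = b * a) (p q : Proj M) :
    (Proj.inter hM p q).op = p.op * q.op := rfl

/-- The operator `0` as a projection of `M`. -/
def Proj.zero (M : VonNeumannAlgebra H) : Proj M := Proj.mk 0 (zero_mem M) (.zero _)

/-! ### Elements of the algebra through their cuts, and the derivation at bounded operators -/

section Derivation

variable {τ : FiniteTrace M} {Λ : Set (ℝ → ℝ)}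

theorem exists_cut_of_mem_arensAlgebra (hΛ : IsQuadraticFamily Λ) {x : H →ₗ.[ℂ] H}
    (hx : x ∈ arensAlgebra τ Λ) : ∃ (e : ℕ → Proj M) (b : ℕ → H →L[ℂ] H),
      (∀ n, Cut x (e n).op (b n)) ∧
      ∀ ξ, Filter.Tendsto (fun n => (e n).op ξ) Filter.atTop (nhds ξ) := by
  obtain ⟨φ, hφ⟩ := hΛ.nonempty
  obtain ⟨e, b, -, h1, h2⟩ := exists_cut_of_mem_orliczSpace (hx.2 φ hφ)
  exact ⟨e, b, h1, h2⟩

theorem dense_domain (hΛ : IsQuadraticFamily Λ) {x : H →ₗ.[ℂ] H} (hx : x ∈ arensAlgebra τ Λ) :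
    Dense (x.domain : Set H) := by
  obtain ⟨e, b, h1, h2⟩ := exists_cut_of_mem_arensAlgebra hΛ hx
  exact fun ξ => mem_closure_of_tendsto (h2 ξ)
    (.of_forall fun n => LinearPMap.mem_domain_of_mem_graph (h1 n ξ))

theorem ofCLM_strongMul_eq_of_cut (hM : ∀ a ∈ M, ∀ b ∈ M, a * b = b * a)
    (hΛ : IsQuadraticFamily Λ) {x : H →ₗ.[ℂ] H} (hx : x ∈ arensAlgebra τ Λ) {e : Proj M}
    {b : H →L[ℂ] H} (hb : Cut x e.op b) : strongMul (ofCLM e.op) x = ofCLM b :=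
  ofCLM_strongMul_eq_ofCLM (dense_domain hΛ hx) fun _ _ h => hb.apply_eq hM hx.1.2.1 h

/-- An element of the algebra whose cuts vanish is zero. -/
theorem eq_ofCLM_zero_of_cut (hM : ∀ a ∈ M, ∀ b ∈ M, a * b = b * a) (hΛ : IsQuadraticFamily Λ)
    {x : H →ₗ.[ℂ] H} (hx : x ∈ arensAlgebra τ Λ)
    (h : ∀ (e : Proj M) (b : H →L[ℂ] H), Cut x e.op b → b = 0) : x = ofCLM 0 := by
  obtain ⟨e, b, h1, h2⟩ := exists_cut_of_mem_arensAlgebra hΛ hx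
  have h0 := ofCLM_mem_measurableOps τ (zero_mem M)
  refine eq_of_cut hM hx.1.1 h0.1 hx.1.2.1 h0.2.1 h2 h1 fun n => ?_
  rw [h _ _ (h1 n), ← zero_mul (e n).op]
  exact cut_ofCLM 0 _

/-- A derivation of the algebra, evaluated at a bounded operator. -/
def bddDer (δ : arensAlgebra τ Λ → arensAlgebra τ Λ) (a : H →L[ℂ] H) : H →ₗ.[ℂ] H :=
  open Classical in
  -- For `a ∈ M` the default is never taken, by `ofCLM_mem_arensAlgebra`.
  if h : ofCLM a ∈ arensAlgebra τ Λ then (δ ⟨ofCLM a, h⟩).1 else ofCLM 0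

variable {δ : arensAlgebra τ Λ → arensAlgebra τ Λ}

theorem bddDer_eq {x : arensAlgebra τ Λ} {a : H →L[ℂ] H} (h : x.1 = ofCLM a) :
    (δ x).1 = bddDer δ a := by
  obtain ⟨x, hx⟩ := x
  obtain rfl : x = ofCLM a := h
  rw [bddDer, dif_pos hx]

theorem bddDer_mem (hΛ : IsQuadraticFamily Λ) {a : H →L[ℂ] H} (ha : a ∈ M) :
    bddDer δ a ∈ arensAlgebra τ Λ := by
  rw [← bddDer_eq (x := ⟨ofCLM a, ofCLM_mem_arensAlgebra τ hΛ ha⟩) rfl]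
  exact (δ _).2

theorem bddDer_add (hΛ : IsQuadraticFamily Λ) (hδ : IsAdditiveDerivation δ) {a b : H →L[ℂ] H}
    (ha : a ∈ M) (hb : b ∈ M) : bddDer δ (a + b) = strongAdd (bddDer δ a) (bddDer δ b) := by
  have := hδ.map_add ⟨ofCLM a, ofCLM_mem_arensAlgebra τ hΛ ha⟩
    ⟨ofCLM b, ofCLM_mem_arensAlgebra τ hΛ hb⟩
    ⟨ofCLM (a + b), ofCLM_mem_arensAlgebra τ hΛ (add_mem ha hb)⟩ (strongAdd_ofCLM a b).symm
  rwa [bddDer_eq rfl, bddDer_eq rfl, bddDer_eq rfl] at this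

theorem bddDer_mul (hΛ : IsQuadraticFamily Λ) (hδ : IsAdditiveDerivation δ) {a b : H →L[ℂ] H}
    (ha : a ∈ M) (hb : b ∈ M) : bddDer δ (a * b)
      = strongAdd (strongMul (bddDer δ a) (ofCLM b)) (strongMul (ofCLM a) (bddDer δ b)) := by
  have := hδ.leibniz ⟨ofCLM a, ofCLM_mem_arensAlgebra τ hΛ ha⟩
    ⟨ofCLM b, ofCLM_mem_arensAlgebra τ hΛ hb⟩
    ⟨ofCLM (a * b), ofCLM_mem_arensAlgebra τ hΛ (mul_mem ha hb)⟩ (strongMul_ofCLM_ofCLM a b).symm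
  rwa [bddDer_eq rfl, bddDer_eq rfl, bddDer_eq rfl] at this

theorem cut_bddDer_add (hΛ : IsQuadraticFamily Λ) (hδ : IsAdditiveDerivation δ)
    {a b : H →L[ℂ] H} (ha : a ∈ M) (hb : b ∈ M) {e c d : H →L[ℂ] H}
    (hc : Cut (bddDer δ a) e c) (hd : Cut (bddDer δ b) e d) :
    Cut (bddDer δ (a + b)) e (c + d) := by
  rw [bddDer_add hΛ hδ ha hb]
  exact hc.strongAdd hd

theorem cut_bddDer_mul (hM : ∀ a ∈ M, ∀ b ∈ M, a * b = b * a) (hΛ : IsQuadraticFamily Λ)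
    (hδ : IsAdditiveDerivation δ) {a b : H →L[ℂ] H} (ha : a ∈ M) (hb : b ∈ M) {e : Proj M}
    {c d : H →L[ℂ] H} (hc : Cut (bddDer δ a) e.op c) (hd : Cut (bddDer δ b) e.op d) :
    Cut (bddDer δ (a * b)) e.op (c * b + a * d) := by
  rw [bddDer_mul hΛ hδ ha hb]
  exact (hc.strongMul_ofCLM (hM _ hb _ e.op_mem)).strongAdd (hd.ofCLM_strongMul a)

theorem cut_ofCLM_zero (e : H →L[ℂ] H) : Cut (ofCLM (0 : H →L[ℂ] H)) e 0 := by
  have := cut_ofCLM 0 e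
  rwa [zero_mul] at this

/-! ### Derivations vanish on Gaussian integer combinations of projections -/

/-- On a cut `b` of `δ(p)`, the identity `p² = p` reads `b = 2pb`. Multiplying by `p` gives `pb =
0`, hence `b = 0`. -/
theorem bddDer_op (hM : ∀ a ∈ M, ∀ b ∈ M, a * b = b * a) (hΛ : IsQuadraticFamily Λ)
    (hδ : IsAdditiveDerivation δ) (p : Proj M) : bddDer δ p.op = ofCLM 0 := by
  refine eq_ofCLM_zero_of_cut hM hΛ (bddDer_mem hΛ p.op_mem) fun e b hb => ?_
  have hbM := hb.mem (bddDer_mem hΛ p.op_mem).1.2.1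
  have h1 := cut_bddDer_mul hM hΛ hδ p.op_mem p.op_mem hb hb
  rw [p.op_op] at h1
  have h2 := hb.unique h1
  rw [hM _ hbM _ p.op_mem] at h2
  have h3 : p.op * b = p.op * b + p.op * b := by
    conv_lhs => rw [h2]
    rw [mul_add, ← mul_assoc, p.op_op]
  rw [left_eq_add.1 h3, add_zero] at h2
  exact h2

theorem bddDer_eq_zero_of_add (hM : ∀ a ∈ M, ∀ b ∈ M, a * b = b * a) (hΛ : IsQuadraticFamily Λ)
    (hδ : IsAdditiveDerivation δ) {a b : H →L[ℂ] H} (ha : a ∈ M) (hb : b ∈ M)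
    (h1 : bddDer δ a = ofCLM 0) (h2 : bddDer δ (a + b) = ofCLM 0) : bddDer δ b = ofCLM 0 := by
  refine eq_ofCLM_zero_of_cut hM hΛ (bddDer_mem hΛ hb) fun e c hc => ?_
  have h3 := cut_bddDer_add hΛ hδ ha hb (h1 ▸ cut_ofCLM_zero e.op) hc
  rw [h2, zero_add] at h3
  exact h3.unique (cut_ofCLM_zero _)

theorem bddDer_zero (hM : ∀ a ∈ M, ∀ b ∈ M, a * b = b * a) (hΛ : IsQuadraticFamily Λ)
    (hδ : IsAdditiveDerivation δ) : bddDer δ 0 = ofCLM 0 :=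
  bddDer_op hM hΛ hδ (Proj.zero M)

theorem bddDer_add_eq_zero (hΛ : IsQuadraticFamily Λ)
    (hδ : IsAdditiveDerivation δ) {a b : H →L[ℂ] H} (ha : a ∈ M) (hb : b ∈ M)
    (h1 : bddDer δ a = ofCLM 0) (h2 : bddDer δ b = ofCLM 0) : bddDer δ (a + b) = ofCLM 0 := by
  rw [bddDer_add hΛ hδ ha hb, h1, h2, strongAdd_ofCLM, add_zero]

theorem bddDer_neg_eq_zero (hM : ∀ a ∈ M, ∀ b ∈ M, a * b = b * a) (hΛ : IsQuadraticFamily Λ)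
    (hδ : IsAdditiveDerivation δ) {a : H →L[ℂ] H} (ha : a ∈ M) (h : bddDer δ a = ofCLM 0) :
    bddDer δ (-a) = ofCLM 0 := by
  refine bddDer_eq_zero_of_add hM hΛ hδ ha (neg_mem ha) h ?_
  rw [add_neg_cancel, bddDer_zero hM hΛ hδ]

/-- From `(ip)² = -p` and `δ(-p) = 0` comes `pδ(ip) = 0`; then `ip = p · ip` and `δ(p) = 0` give
`δ(ip) = pδ(ip) = 0`. -/
theorem bddDer_I_smul_op (hM : ∀ a ∈ M, ∀ b ∈ M, a * b = b * a) (hΛ : IsQuadraticFamily Λ)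
    (hδ : IsAdditiveDerivation δ) (p : Proj M) : bddDer δ (Complex.I • p.op) = ofCLM 0 := by
  have hip : Complex.I • p.op ∈ M := M.toStarSubalgebra.smul_mem p.op_mem _
  refine eq_ofCLM_zero_of_cut hM hΛ (bddDer_mem hΛ hip) fun e b hb => ?_
  have hbM := hb.mem (bddDer_mem hΛ hip).1.2.1
  have h1 := cut_bddDer_mul hM hΛ hδ hip hip hb hb
  have e1 : (Complex.I • p.op) * (Complex.I • p.op) = -p.op := by
    rw [smul_mul_smul_comm, p.op_op, Complex.I_mul_I, neg_one_smul]
  rw [e1, bddDer_neg_eq_zero hM hΛ hδ p.op_mem (bddDer_op hM hΛ hδ p),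
    hM _ hbM _ hip, ← two_smul ℂ] at h1
  have h2 := h1.unique (cut_ofCLM_zero _)
  rw [smul_mul_assoc, smul_smul] at h2
  have h3 : p.op * b = 0 := (smul_eq_zero.1 h2).resolve_left (by simp)
  have h4 := cut_bddDer_mul hM hΛ hδ p.op_mem hip
    ((bddDer_op hM hΛ hδ p) ▸ cut_ofCLM_zero e.op) hb
  rw [mul_smul_comm, p.op_op, h3, zero_mul, add_zero] at h4
  exact hb.unique h4

theorem bddDer_gaussian (hM : ∀ a ∈ M, ∀ b ∈ M, a * b = b * a) (hΛ : IsQuadraticFamily Λ)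
    (hδ : IsAdditiveDerivation δ) {s t : H →L[ℂ] H}
    (hs : s ∈ AddSubgroup.closure (Set.range (Proj.op (M := M))))
    (ht : t ∈ AddSubgroup.closure (Set.range (Proj.op (M := M)))) :
    bddDer δ (s + Complex.I • t) = ofCLM 0 := by
  have hsmul : ∀ {t : H →L[ℂ] H}, t ∈ AddSubgroup.closure (Set.range (Proj.op (M := M))) →
      Complex.I • t ∈ M := fun ht =>
    M.toStarSubalgebra.smul_mem (mem_of_mem_closure_range_op ht) _
  have h1 : bddDer δ s = ofCLM 0 := by
    induction hs using AddSubgroup.closure_induction with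
    | mem x hx => obtain ⟨p, rfl⟩ := hx; exact bddDer_op hM hΛ hδ p
    | zero => exact bddDer_zero hM hΛ hδ
    | add x y hx hy h1 h2 =>
      exact bddDer_add_eq_zero hΛ hδ (mem_of_mem_closure_range_op hx)
        (mem_of_mem_closure_range_op hy) h1 h2
    | neg x hx h1 => exact bddDer_neg_eq_zero hM hΛ hδ (mem_of_mem_closure_range_op hx) h1
  have h2 : bddDer δ (Complex.I • t) = ofCLM 0 := by
    induction ht using AddSubgroup.closure_induction with
    | mem x hx => obtain ⟨p, rfl⟩ := hx; exact bddDer_I_smul_op hM hΛ hδ p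
    | zero => rw [smul_zero]; exact bddDer_zero hM hΛ hδ
    | add x y hx hy h1 h2 =>
      rw [smul_add]
      exact bddDer_add_eq_zero hΛ hδ (hsmul hx) (hsmul hy) h1 h2
    | neg x hx h1 => rw [smul_neg]; exact bddDer_neg_eq_zero hM hΛ hδ (hsmul hx) h1
  exact bddDer_add_eq_zero hΛ hδ (mem_of_mem_closure_range_op hs) (hsmul ht) h1 h2

/-! ### Locality -/

/-- Here `b = gx` and `δ(g) = 0`, so `δ(b) = gδ(x)`: questions about unbounded `x` reduce to bounded
elements. The cut of `x` along `f` lets the term `δ(g)x = 0·x` be evaluated there. -/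
theorem cut_bddDer_of_cut (hM : ∀ a ∈ M, ∀ b ∈ M, a * b = b * a) (hΛ : IsQuadraticFamily Λ)
    (hδ : IsAdditiveDerivation δ) (x : arensAlgebra τ Λ) {g f : Proj M} {b b' c : H →L[ℂ] H}
    (hb : Cut x.1 g.op b) (hb' : Cut x.1 f.op b') (hc : Cut (δ x).1 f.op c) :
    Cut (bddDer δ b) f.op (g.op * c) := by
  have h1 := hδ.leibniz ⟨ofCLM g.op, ofCLM_mem_arensAlgebra τ hΛ g.op_mem⟩ x
    ⟨ofCLM b, ofCLM_mem_arensAlgebra τ hΛ (hb.mem x.2.1.2.1)⟩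
    (ofCLM_strongMul_eq_of_cut hM hΛ x.2 hb).symm
  rw [bddDer_eq rfl, bddDer_eq rfl, bddDer_op hM hΛ hδ g] at h1
  rw [h1]
  have h2 := (hb'.ofCLM_strongMul 0).strongAdd (hc.ofCLM_strongMul g.op)
  rwa [zero_mul, zero_add] at h2

/-- Because `δ(r) = 0`, one has `δ(a)r = δ(ar)`, which depends only on `ar`. -/
theorem cut_bddDer_congr (hM : ∀ a ∈ M, ∀ b ∈ M, a * b = b * a) (hΛ : IsQuadraticFamily Λ)
    (hδ : IsAdditiveDerivation δ) {a a' : H →L[ℂ] H} (ha : a ∈ M) (ha' : a' ∈ M) {r : Proj M}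
    (h : a * r.op = a' * r.op) {c : H →L[ℂ] H} (hc : Cut (bddDer δ a') r.op c) :
    Cut (bddDer δ a) r.op c := by
  obtain ⟨e, d, hd, he⟩ := exists_cut_of_mem_arensAlgebra hΛ (bddDer_mem (δ := δ) hΛ ha)
  have h0 : ∀ e : Proj M, Cut (bddDer δ r.op) e.op 0 := fun e =>
    (bddDer_op hM hΛ hδ r) ▸ cut_ofCLM_zero e.op
  have h1 := cut_bddDer_mul hM hΛ hδ ha' r.op_mem hc (h0 r)
  rw [mul_zero, add_zero, hc.mul_op, ← h] at h1
  have h2 : ∀ n, d n * r.op = c * (e n).op := by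
    intro n
    have h3 := cut_bddDer_mul hM hΛ hδ ha r.op_mem (hd n) (h0 _)
    rw [mul_zero, add_zero] at h3
    have h4 := h3.mul r.op
    rw [mul_assoc, r.op_op, hM _ (e n).op_mem _ r.op_mem] at h4
    exact h4.unique (h1.mul (e n).op)
  intro ξ
  -- The points `(e_n rξ, d_n rξ) = (e_n rξ, c e_n ξ)` lie in the closed graph of `δ(a)` and tend to
  -- `(rξ, cξ)`.
  refine (bddDer_mem (δ := δ) hΛ ha).1.1.mem_of_tendsto
    ((he (r.op ξ)).prodMk_nhds ((c.continuous.tendsto _).comp (he ξ))) (.of_forall fun n => ?_)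
  have h5 : c ((e n).op ξ) = d n (r.op ξ) :=
    congrArg (fun A : H →L[ℂ] H => A ξ) (h2 n).symm
  change ((e n).op (r.op ξ), c ((e n).op ξ)) ∈ _
  rw [h5]
  exact hd n (r.op ξ)

/-! ### Null and active projections -/

/-- `p δ = 0`. -/
def IsNull (δ : arensAlgebra τ Λ → arensAlgebra τ Λ) (p : Proj M) : Prop :=
  ∀ (x : arensAlgebra τ Λ) (f : Proj M) (c : H →L[ℂ] H), Cut (δ x).1 f.op c → p.op * c = 0

/-- `r` is nonzero and some value of `δ` at a bounded operator is bounded and bounded below on the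
range of `r`. -/
def IsActive (δ : arensAlgebra τ Λ → arensAlgebra τ Λ) (r : Proj M) : Prop :=
  r.op ≠ 0 ∧ ∃ b ∈ M, ∃ (c : H →L[ℂ] H) (ε : ℝ), 0 < ε ∧ Cut (bddDer δ b) r.op c ∧
    ∀ ξ, ε * ‖r.op ξ‖ ≤ ‖c ξ‖

theorem IsActive.of_mul_eq (hM : ∀ a ∈ M, ∀ b ∈ M, a * b = b * a) {r r' : Proj M}
    (h : IsActive δ r) (h0 : r'.op ≠ 0) (hr : r'.op * r.op = r'.op) : IsActive δ r' := by
  obtain ⟨-, b, hb, c, ε, hε, hc, hle⟩ := h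
  have hr' : r.op * r'.op = r'.op := by rw [hM _ r.op_mem _ r'.op_mem, hr]
  refine ⟨h0, b, hb, c * r'.op, ε, hε, ?_, fun ξ => ?_⟩
  · have := hc.mul r'.op
    rwa [hr'] at this
  · have := hle (r'.op ξ)
    rwa [← mul_apply_eq_comp, hr'] at this

theorem IsActive.not_isNull (hM : ∀ a ∈ M, ∀ b ∈ M, a * b = b * a) (hΛ : IsQuadraticFamily Λ)
    {r : Proj M} (h : IsActive δ r) : ¬ IsNull δ r := by
  obtain ⟨h0, b, hb, c, ε, hε, hc, hle⟩ := h
  intro hn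
  refine h0 ?_
  have h1 := hn ⟨ofCLM b, ofCLM_mem_arensAlgebra τ hΛ hb⟩ r c (by rwa [bddDer_eq rfl])
  rw [hc.op_mul hM (bddDer_mem hΛ hb).1.2.1] at h1
  ext ξ
  have h2 := hle ξ
  rw [h1, zero_apply, norm_zero] at h2
  have h3 : ‖r.op ξ‖ ≤ 0 := by
    by_contra h
    push Not at h
    nlinarith
  simpa using h3

/-- Cut `x` and `δ(x)` along a common projection `g`, so that the bounded element `gx` has
derivative `c'` on `g` with `pc' ≠ 0`; then take a spectral projection on which `pc'` is bounded
below. -/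
theorem exists_isActive_of_not_isNull (hM : ∀ a ∈ M, ∀ b ∈ M, a * b = b * a)
    (hΛ : IsQuadraticFamily Λ) (hδ : IsAdditiveDerivation δ) {p : Proj M} (hp : ¬ IsNull δ p) :
    ∃ r : Proj M, IsActive δ r ∧ r.op * p.op = r.op := by
  simp only [IsNull, not_forall] at hp
  obtain ⟨x, f, c, hc, hpc⟩ := hp
  have hcM := hc.mem (δ x).2.1.2.1
  obtain ⟨e, b, hb, he⟩ := exists_cut_of_mem_arensAlgebra hΛ x.2
  obtain ⟨n, hn⟩ : ∃ n, p.op * (c * (e n).op) ≠ 0 := by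
    by_contra hcon
    push Not at hcon
    refine hpc ?_
    ext ξ
    refine tendsto_nhds_unique (((p.op * c).continuous.tendsto _).comp (he ξ)) ?_
    refine tendsto_const_nhds.congr fun n => ?_
    have := congrArg (fun A : H →L[ℂ] H => A ξ) (hcon n)
    exact this.symm
  set g := Proj.inter hM f (e n) with hg
  have hcg : Cut (δ x).1 g.op (c * (e n).op) := hc.mul _
  have hbg : Cut x.1 g.op (b n * f.op) := by
    rw [hg, Proj.op_inter, hM _ f.op_mem _ (e n).op_mem]
    exact (hb n).mul _
  have hbM := hbg.mem x.2.1.2.1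
  have hD := cut_bddDer_of_cut hM hΛ hδ x hbg hbg hcg
  rw [hcg.op_mul hM (δ x).2.1.2.1] at hD
  set c' := c * (e n).op with hc'
  have hc'M : c' ∈ M := mul_mem hcM (e n).op_mem
  have hgc : g.op * c' = c' := hcg.op_mul hM (δ x).2.1.2.1
  clear_value c'
  have haM : p.op * c' ∈ M := mul_mem p.op_mem hc'M
  obtain ⟨r, ε, hr0, hε, hle⟩ := exists_proj_bddBelow haM hn
  -- In either case `pc'` kills `1 - q`, yet it is bounded below on the range of `r`, so `r(1 - q) =
  -- 0`. Used for `q = g` and `q = p`.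
  have key : ∀ q : Proj M, q.op * c' = c' ∨ q = p → r.op * q.op = r.op := by
    intro q hq
    have h1 : p.op * c' * (1 - q.op) = 0 := by
      rw [mul_sub, mul_one, hM _ haM _ q.op_mem]
      rcases hq with hq | rfl
      · rw [← mul_assoc, hM _ q.op_mem _ p.op_mem, mul_assoc, hq, sub_self]
      · rw [← mul_assoc, q.op_op, sub_self]
    have h2 : r.op * (1 - q.op) = 0 := by
      ext ξ
      have h3 := hle ((1 - q.op) ξ)
      have h4 : (p.op * c') (r.op ((1 - q.op) ξ)) = 0 := by
        have : p.op * c' * (r.op * (1 - q.op)) = 0 := by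
          rw [hM _ r.op_mem _ (sub_mem (one_mem M) q.op_mem), ← mul_assoc, h1, zero_mul]
        exact congrArg (fun A : H →L[ℂ] H => A ξ) this
      rw [h4, norm_zero] at h3
      have h5 : ‖r.op ((1 - q.op) ξ)‖ ≤ 0 := by
        by_contra h
        push Not at h
        nlinarith
      simpa using h5
    rw [mul_sub, mul_one, sub_eq_zero] at h2
    exact h2.symm
  have hrg : g.op * r.op = r.op := by
    rw [hM _ g.op_mem _ r.op_mem]
    exact key g (.inl hgc)
  refine ⟨r, ⟨hr0, _, hbM, c' * r.op, ε, hε, ?_, fun ξ => (hle ξ).trans ?_⟩, key p (.inr rfl)⟩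
  · have := hD.mul r.op
    rwa [hrg] at this
  · exact norm_apply_le_of_isStarProjection p.isStarProjection_op _

theorem cut_bddDer_nsmul (hM : ∀ a ∈ M, ∀ b ∈ M, a * b = b * a) (hΛ : IsQuadraticFamily Λ)
    (hδ : IsAdditiveDerivation δ) {b e c : H →L[ℂ] H} (hb : b ∈ M)
    (hc : Cut (bddDer δ b) e c) (n : ℕ) : Cut (bddDer δ (n • b)) e (n • c) := by
  induction n with
  | zero =>
    rw [zero_smul, zero_smul, bddDer_zero hM hΛ hδ]
    exact cut_ofCLM_zero e
  | succ n ih =>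
    rw [succ_nsmul, succ_nsmul]
    exact cut_bddDer_add hΛ hδ (nsmul_mem hb n) hb ih hc

/-- On an active projection the derivation of a uniformly bounded element can be made large. -/
theorem exists_bounded_large (hM : ∀ a ∈ M, ∀ b ∈ M, a * b = b * a) (hΛ : IsQuadraticFamily Λ)
    (hδ : IsAdditiveDerivation δ) {r : Proj M} (hr : IsActive δ r) (K : ℝ) :
    ∃ x ∈ M, ∃ c : H →L[ℂ] H, ‖x‖ ≤ 2 ∧ Cut (bddDer δ x) r.op c ∧
      ∀ ξ, K * ‖r.op ξ‖ ≤ ‖c ξ‖ := by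
  obtain ⟨-, b, hb, c, ε, hε, hc, hle⟩ := hr
  obtain ⟨n, hn⟩ := exists_nat_ge (K / ε)
  have hnb : n • b ∈ M := nsmul_mem hb n
  -- Subtracting `s + it` from `nb` brings the norm down to 2 and leaves the derivative `nc`
  -- unchanged.
  obtain ⟨s, hs, t, ht, hst⟩ := exists_approx hM hnb
  have hstM : s + Complex.I • t ∈ M := add_mem (mem_of_mem_closure_range_op hs)
    (M.toStarSubalgebra.smul_mem (mem_of_mem_closure_range_op ht) _)
  refine ⟨n • b - (s + Complex.I • t), sub_mem hnb hstM, n • c, hst, ?_, fun ξ => ?_⟩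
  · have h0 := bddDer_neg_eq_zero hM hΛ hδ hstM (bddDer_gaussian hM hΛ hδ hs ht)
    have h1 := cut_bddDer_add hΛ hδ hnb (neg_mem hstM) (cut_bddDer_nsmul hM hΛ hδ hb hc n)
      (h0 ▸ cut_ofCLM_zero r.op)
    rwa [add_zero, ← sub_eq_add_neg] at h1
  · have h1 : (n • c) ξ = (n : ℂ) • c ξ := by simp [Nat.cast_smul_eq_nsmul]
    rw [h1, norm_smul, Complex.norm_natCast]
    rw [div_le_iff₀ hε] at hn
    calc K * ‖r.op ξ‖ ≤ n * ε * ‖r.op ξ‖ := by gcongr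
      _ = n * (ε * ‖r.op ξ‖) := by ring
      _ ≤ n * ‖c ξ‖ := by gcongr; exact hle ξ

/-- There is no infinite orthogonal sequence of active projections. -/
theorem not_exists_orthogonal_active (hM : ∀ a ∈ M, ∀ b ∈ M, a * b = b * a)
    (hΛ : IsQuadraticFamily Λ) (hδ : IsAdditiveDerivation δ) (r : ℕ → Proj M)
    (hr : ∀ i j, i ≠ j → (r i).op * (r j).op = 0) (hact : ∀ n, IsActive δ (r n)) : False := by
  obtain ⟨φ, hφ⟩ := hΛ.nonempty
  have hY := hΛ.young φ hφ
  have hτ : ∀ n, 0 < τ.val (r n).1 := fun n => τ.val_pos (hact n).1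
  -- Thus `φ(t_n) τ(r_n) ≥ 2`, to contradict the bound 1 of the unit ball. The extra factor `n` in
  -- the next line absorbs the unknown scale `k` in `δ(a) = ky`.
  choose t ht0 ht using fun n => hY.exists_ge (2 / τ.val (r n).1)
  choose x hxM c hx2 hc hcle using fun n =>
    exists_bounded_large hM hΛ hδ (hact n) ((n : ℝ) * (t n + 1))
  obtain ⟨a, haM, ha⟩ := exists_glue hM hr hxM hx2
  obtain ⟨k, hk, y, hy, hky⟩ := (bddDer_mem (δ := δ) hΛ haM).2 φ hφ
  have hk0 : (k : ℂ) ≠ 0 := by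
    have : k ≠ 0 := by omega
    exact_mod_cast this
  have hk0' : (0 : ℝ) < k := by exact_mod_cast hk
  -- The index is taken equal to the scale `k`: on `r_k`, `y = k⁻¹δ(a)` is bounded below by `t_k + 1
  -- > t_k`.
  have hcut := cut_bddDer_congr hM hΛ hδ haM (hxM k) (ha k) (hc k)
  have hcuty : Cut y (r k).op ((k : ℂ)⁻¹ • c k) := by
    intro ξ
    have h1 := hcut ξ
    rw [hky, LinearPMap.mem_graph_iff] at h1
    obtain ⟨v, hv1, hv2⟩ := h1
    refine (LinearPMap.mem_graph_iff _).2 ⟨⟨v, v.2⟩, hv1, ?_⟩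
    change _ = (k : ℂ)⁻¹ • c k ξ
    have hv3 : (k : ℂ) • y ⟨v, v.2⟩ = c k ξ := hv2
    rw [← hv3, smul_smul, inv_mul_cancel₀ hk0, one_smul]
  have h1 := young_mul_trace_le_one hY hM hy (r k) hcuty (c := t k + 1) (fun ξ => by
    rw [smul_apply, norm_smul, norm_inv, Complex.norm_natCast, le_inv_mul_iff₀ hk0', ← mul_assoc]
    exact hcle k ξ) (ht0 k) (by linarith)
  have h2 := ht k
  rw [div_le_iff₀ (hτ k)] at h2
  linarith

end Derivation

/-! ### Atoms -/

theorem Proj.le_iff {p q : Proj M} : p ≤ q ↔ p.op * q.op = p.op :=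
  p.isStarProjection_op.le_iff_mul_eq_left q.isStarProjection_op

theorem Proj.IsMinimal.mul_op {q : Proj M} (hM : ∀ a ∈ M, ∀ b ∈ M, a * b = b * a)
    (hq : q.IsMinimal) (p : Proj M) : p.op * q.op = 0 ∨ p.op * q.op = q.op := by
  rcases hq.2 (Proj.inter hM p q) (Proj.le_iff.2 (by
    rw [Proj.op_inter, mul_assoc, q.op_op])) with h | h
  · exact .inl h
  · exact .inr (congrArg Proj.op h)

theorem Proj.IsMinimal.mul_eq_zero {p q : Proj M} (hM : ∀ a ∈ M, ∀ b ∈ M, a * b = b * a)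
    (hp : p.IsMinimal) (hq : q.IsMinimal) (hpq : p ≠ q) : p.op * q.op = 0 := by
  refine (hq.mul_op hM p).resolve_right fun h1 => ?_
  rcases hp.mul_op hM q with h2 | h2
  · rw [hM _ p.op_mem _ q.op_mem, h2] at h1
    exact hq.1 h1.symm
  · rw [hM _ q.op_mem _ p.op_mem, h1] at h2
    exact hpq (Proj.ext_op h2.symm)

theorem Proj.IsMinimal.exists_smul_of_mem_closure {q : Proj M}
    (hM : ∀ a ∈ M, ∀ b ∈ M, a * b = b * a) (hq : q.IsMinimal) {s : H →L[ℂ] H}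
    (hs : s ∈ AddSubgroup.closure (Set.range (Proj.op (M := M)))) :
    ∃ c : ℂ, s * q.op = c • q.op := by
  induction hs using AddSubgroup.closure_induction with
  | mem x hx =>
    obtain ⟨p, rfl⟩ := hx
    rcases hq.mul_op hM p with h | h
    · exact ⟨0, by rw [h, zero_smul]⟩
    · exact ⟨1, by rw [h, one_smul]⟩
  | zero => exact ⟨0, by rw [zero_mul, zero_smul]⟩
  | add x y _ _ h1 h2 =>
    obtain ⟨c, hc⟩ := h1
    obtain ⟨d, hd⟩ := h2
    exact ⟨c + d, by rw [add_mul, hc, hd, add_smul]⟩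
  | neg x _ h1 =>
    obtain ⟨c, hc⟩ := h1
    exact ⟨-c, by rw [neg_mul, hc, neg_smul]⟩

/-- `q M = ℂ q` for an atom `q`. -/
theorem Proj.IsMinimal.exists_smul {q : Proj M} (hM : ∀ a ∈ M, ∀ b ∈ M, a * b = b * a)
    (hq : q.IsMinimal) {a : H →L[ℂ] H} (ha : a ∈ M) : ∃ c : ℂ, a * q.op = c • q.op := by
  have hcl : IsClosed (Submodule.span ℂ {q.op} : Set (H →L[ℂ] H)) :=
    Submodule.closed_of_finiteDimensional _
  -- Approximating `na` within 2 and dividing by `n` puts `aq` within `2/n` of the line `ℂq`.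
  have hmem : a * q.op ∈ closure (Submodule.span ℂ {q.op} : Set (H →L[ℂ] H)) := by
    rw [Metric.mem_closure_iff]
    intro ε hε
    obtain ⟨n, hn⟩ := exists_nat_gt (2 / ε)
    have hn0 : (0 : ℝ) < n := (by positivity : (0 : ℝ) < 2 / ε).trans hn
    obtain ⟨s, hs, t, ht, hst⟩ := exists_approx hM (nsmul_mem ha n)
    obtain ⟨c, hc⟩ := hq.exists_smul_of_mem_closure hM hs
    obtain ⟨d, hd⟩ := hq.exists_smul_of_mem_closure hM ht
    refine ⟨((n : ℂ)⁻¹ * (c + Complex.I * d)) • q.op,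
      Submodule.smul_mem _ _ (Submodule.mem_span_singleton_self _), ?_⟩
    have hnC : (n : ℂ) ≠ 0 := by exact_mod_cast hn0.ne'
    have h1 : a * q.op - ((n : ℂ)⁻¹ * (c + Complex.I * d)) • q.op
        = (n : ℂ)⁻¹ • ((n • a - (s + Complex.I • t)) * q.op) := by
      rw [sub_mul, add_mul, smul_mul_assoc, smul_mul_assoc, hc, hd, smul_smul, ← add_smul, smul_sub,
        smul_smul, ← Nat.cast_smul_eq_nsmul ℂ, smul_smul, inv_mul_cancel₀ hnC, one_smul]
    rw [dist_eq_norm, h1, norm_smul, norm_inv, Complex.norm_natCast]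
    have h2 : ‖(n • a - (s + Complex.I • t)) * q.op‖ ≤ 2 := by
      refine (norm_mul_le _ _).trans ?_
      have := q.isStarProjection_op.norm_le
      nlinarith [norm_nonneg (n • a - (s + Complex.I • t)), norm_nonneg q.op]
    rw [inv_mul_lt_iff₀ hn0]
    rw [div_lt_iff₀ hε] at hn
    linarith
  rw [hcl.closure_eq] at hmem
  obtain ⟨c, hc⟩ := Submodule.mem_span_singleton.1 hmem
  exact ⟨c, hc.symm⟩

theorem smul_op_injective {q : Proj M} (hq : q.op ≠ 0) {c d : ℂ} (h : c • q.op = d • q.op) :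
    c = d := smul_left_injective ℂ hq h

/-! ### Active atoms and the derivations of `ℂ` they carry -/

section Derivation

variable {τ : FiniteTrace M} {Λ : Set (ℝ → ℝ)} {δ : arensAlgebra τ Λ → arensAlgebra τ Λ}

/-- Nonzero subprojections of active projections are active. Without an active atom below `r` there
would be a strictly decreasing chain of active projections, whose consecutive differences form a
forbidden orthogonal sequence. -/
theorem exists_isMinimal_of_isActive (hM : ∀ a ∈ M, ∀ b ∈ M, a * b = b * a)
    (hΛ : IsQuadraticFamily Λ) (hδ : IsAdditiveDerivation δ) {r : Proj M} (hr : IsActive δ r) :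
    ∃ q : Proj M, q.IsMinimal ∧ IsActive δ q ∧ q.op * r.op = q.op := by
  by_contra hcon
  push Not at hcon
  let S := {p : Proj M // IsActive δ p ∧ p.op * r.op = p.op}
  have hstep : ∀ p : S, ∃ p' : S, p'.1.op * p.1.op = p'.1.op ∧ p'.1.op ≠ p.1.op := by
    rintro ⟨p, hp, hpr⟩
    have h1 : ¬ p.IsMinimal := fun h => hcon p h hp hpr
    simp only [Proj.IsMinimal, not_and, not_forall, not_or] at h1
    obtain ⟨p', hle, h0, hne⟩ := h1 hp.1
    have hle' := Proj.le_iff.1 hle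
    exact ⟨⟨p', hp.of_mul_eq hM h0 hle', by rw [← hle', mul_assoc, hpr]⟩, hle',
      fun h => hne (Proj.ext_op h)⟩
  choose g hg hgne using hstep
  let f : ℕ → S := fun n => Nat.rec ⟨r, hr, r.op_op⟩ (fun _ p => g p) n
  have hf : ∀ n, f (n + 1) = g (f n) := fun n => rfl
  have hmono : ∀ m n, m ≤ n → (f n).1.op * (f m).1.op = (f n).1.op := by
    intro m n hmn
    induction n, hmn using Nat.le_induction with
    | base => exact (f m).1.op_op
    | succ n _ ih => rw [← hg (f n), ← hf, mul_assoc, ih]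
  have hcomm : ∀ m n, (f m).1.op * (f n).1.op = (f n).1.op * (f m).1.op := fun m n =>
    hM _ (f m).1.op_mem _ (f n).1.op_mem
  let d : ℕ → Proj M := fun n => Proj.mk ((f n).1.op - (f (n + 1)).1.op)
    (sub_mem (f n).1.op_mem (f (n + 1)).1.op_mem)
    ((f (n + 1)).1.isStarProjection_op.sub_of_mul_eq_left (f n).1.isStarProjection_op
      (hmono n (n + 1) n.le_succ))
  have hd : ∀ n, (d n).op = (f n).1.op - (f (n + 1)).1.op := fun n => rfl
  have horth : ∀ i j, i < j → (d i).op * (d j).op = 0 := by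
    intro i j hij
    rw [hd, hd, sub_mul, mul_sub, mul_sub, hcomm i j, hcomm i (j + 1), hcomm (i + 1) j,
      hcomm (i + 1) (j + 1), hmono i j hij.le, hmono i (j + 1) (by omega), hmono (i + 1) j hij,
      hmono (i + 1) (j + 1) (by omega), sub_self]
  refine not_exists_orthogonal_active hM hΛ hδ d (fun i j hij => ?_) fun n => ?_
  · rcases lt_or_gt_of_ne hij with h | h
    · exact horth i j h
    · rw [hM _ (d i).op_mem _ (d j).op_mem]
      exact horth j i h
  · refine (f n).2.1.of_mul_eq hM (fun h => hgne (f n) ?_) ?_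
    · rw [hd, sub_eq_zero] at h
      exact h.symm
    · rw [hd, sub_mul, (f n).1.op_op, hmono n (n + 1) n.le_succ]

theorem finite_active_atoms (hM : ∀ a ∈ M, ∀ b ∈ M, a * b = b * a) (hΛ : IsQuadraticFamily Λ)
    (hδ : IsAdditiveDerivation δ) : {q : Proj M | q.IsMinimal ∧ IsActive δ q}.Finite := by
  by_contra hinf
  let f := Set.Infinite.natEmbedding _ hinf
  exact not_exists_orthogonal_active hM hΛ hδ (fun n => (f n).1)
    (fun i j hij => (f i).2.1.mul_eq_zero hM (f j).2.1 fun h => hij (f.injective (Subtype.ext h)))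
    fun n => (f n).2.2

/-- Each `e_n q` is 0 or `q` and `e_n q → q`, so some `e_n` dominates `q`; there `xq = b_n q ∈ ℂq`.
-/
theorem exists_cut_of_isMinimal (hM : ∀ a ∈ M, ∀ b ∈ M, a * b = b * a)
    (hΛ : IsQuadraticFamily Λ) {q : Proj M} (hq : q.IsMinimal) {x : H →ₗ.[ℂ] H}
    (hx : x ∈ arensAlgebra τ Λ) : ∃ c : ℂ, Cut x q.op (c • q.op) := by
  obtain ⟨e, b, hb, he⟩ := exists_cut_of_mem_arensAlgebra hΛ hx
  obtain ⟨n, hn⟩ : ∃ n, (e n).op * q.op = q.op := by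
    by_contra hcon
    push Not at hcon
    refine hq.1 ?_
    ext ξ
    refine tendsto_nhds_unique (he (q.op ξ)) (tendsto_const_nhds.congr fun n => ?_)
    exact congrArg (fun A : H →L[ℂ] H => A ξ)
      ((hq.mul_op hM (e n)).resolve_right (hcon n)).symm
  obtain ⟨c, hc⟩ := hq.exists_smul hM ((hb n).mem hx.1.2.1)
  have h := (hb n).mul q.op
  rw [hn, hc] at h
  exact ⟨c, h⟩

/-- Since `lq = lq · q` and `δ(q) = 0`, the value `δ(lq)` is carried by `q`, where it is scalar. -/
theorem exists_bddDer_smul_atom (hM : ∀ a ∈ M, ∀ b ∈ M, a * b = b * a)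
    (hΛ : IsQuadraticFamily Λ) (hδ : IsAdditiveDerivation δ) {q : Proj M} (hq : q.IsMinimal)
    (l : ℂ) : ∃ m : ℂ, bddDer δ (l • q.op) = ofCLM (m • q.op) := by
  have hlq : l • q.op ∈ M := M.toStarSubalgebra.smul_mem q.op_mem _
  have hT := bddDer_mem (δ := δ) hΛ hlq
  obtain ⟨m, hm⟩ := exists_cut_of_isMinimal hM hΛ hq hT
  obtain ⟨e, b, hb, he⟩ := exists_cut_of_mem_arensAlgebra hΛ hT
  have h0 := ofCLM_mem_measurableOps τ (a := m • q.op) (M.toStarSubalgebra.smul_mem q.op_mem _)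
  refine ⟨m, eq_of_cut hM hT.1.1 h0.1 hT.1.2.1 h0.2.1 he hb fun n => ?_⟩
  have h1 := cut_bddDer_mul hM hΛ hδ hlq q.op_mem (hb n)
    ((bddDer_op hM hΛ hδ q) ▸ cut_ofCLM_zero (e n).op)
  rw [smul_mul_assoc, q.op_op, mul_zero, add_zero] at h1
  have h2 := (hb n).mul q.op
  rw [hM _ (e n).op_mem _ q.op_mem] at h2
  rw [(hb n).unique h1, h2.unique (hm.mul (e n).op)]
  exact cut_ofCLM _ _

theorem exists_derivation_of_atom (hM : ∀ a ∈ M, ∀ b ∈ M, a * b = b * a)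
    (hΛ : IsQuadraticFamily Λ) (hδ : IsAdditiveDerivation δ) {q : Proj M} (hq : q.IsMinimal) :
    ∃ d : Derivation ℤ ℂ ℂ, ∀ l : ℂ, bddDer δ (l • q.op) = ofCLM (d l • q.op) := by
  choose f hf using exists_bddDer_smul_atom hM hΛ hδ hq
  have hlq : ∀ l : ℂ, l • q.op ∈ M := fun l => M.toStarSubalgebra.smul_mem q.op_mem _
  have hadd : ∀ l m, f (l + m) = f l + f m := by
    intro l m
    have h := bddDer_add hΛ hδ (hlq l) (hlq m)
    rw [← add_smul, hf, hf, hf, strongAdd_ofCLM, ← add_smul] at h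
    exact smul_op_injective hq.1 (ofCLM_injective h)
  have hmul : ∀ l m, f (l * m) = f l * m + l * f m := by
    intro l m
    have h := bddDer_mul hΛ hδ (hlq l) (hlq m)
    rw [smul_mul_smul_comm, q.op_op, hf, hf, hf, strongMul_ofCLM_ofCLM, strongMul_ofCLM_ofCLM,
      strongAdd_ofCLM, smul_mul_smul_comm, smul_mul_smul_comm, q.op_op, ← add_smul] at h
    exact smul_op_injective hq.1 (ofCLM_injective h)
  refine ⟨Derivation.mk' (AddMonoidHom.mk' f hadd).toIntLinearMap fun l m => ?_, hf⟩
  change f (l * m) = l * f m + m * f l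
  rw [hmul]
  ring

/-- If `d = 0`, then `δ(b)q = δ(bq) = δ(lq) = 0` for every `b ∈ M`, against activity. -/
theorem derivation_ne_zero_of_isActive (hM : ∀ a ∈ M, ∀ b ∈ M, a * b = b * a)
    (hΛ : IsQuadraticFamily Λ) (hδ : IsAdditiveDerivation δ) {q : Proj M} (hq : q.IsMinimal)
    (hact : IsActive δ q) {d : Derivation ℤ ℂ ℂ}
    (hd : ∀ l : ℂ, bddDer δ (l • q.op) = ofCLM (d l • q.op)) : d ≠ 0 := by
  rintro rfl
  obtain ⟨h0, b, hb, c, ε, hε, hc, hle⟩ := hact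
  obtain ⟨l, hl⟩ := hq.exists_smul hM hb
  have h1 := cut_bddDer_mul hM hΛ hδ hb q.op_mem hc
    ((bddDer_op hM hΛ hδ q) ▸ cut_ofCLM_zero q.op)
  rw [hl, hd, Derivation.zero_apply, zero_smul, mul_zero, add_zero, hc.mul_op] at h1
  have h2 := h1.unique (cut_ofCLM_zero _)
  refine h0 ?_
  ext ξ
  have h3 := hle ξ
  rw [h2, zero_apply, norm_zero] at h3
  have h4 : ‖q.op ξ‖ ≤ 0 := by
    by_contra h
    push Not at h
    nlinarith
  simpa using h4

/-- If the atom were orthogonal to `w`, then `qδ = qwδ = 0`, contradicting activity. -/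
theorem mul_op_eq_of_mem_supportSet (hM : ∀ a ∈ M, ∀ b ∈ M, a * b = b * a)
    (hΛ : IsQuadraticFamily Λ) {q w : Proj M} (hq : q.IsMinimal)
    (hact : IsActive δ q) (hw : w ∈ supportSet δ) : q.op * w.op = q.op := by
  rw [hM _ q.op_mem _ w.op_mem]
  refine (hq.mul_op hM w).resolve_left fun h => hact.not_isNull hM hΛ fun x f c hc => ?_
  have h1 := hc.ofCLM_strongMul w.op
  rw [hw x] at h1
  rw [hc.unique h1, ← mul_assoc, hM _ q.op_mem _ w.op_mem, h, zero_mul]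

end Derivation

theorem isStarProjection_sum {ι : Type*} [Fintype ι] {q : ι → H →L[ℂ] H}
    (hq : ∀ i, IsStarProjection (q i)) (horth : ∀ i j, i ≠ j → q i * q j = 0) :
    IsStarProjection (∑ i, q i) := by
  refine isStarProjection_of_norm_sq fun ξ => ?_
  rw [sum_apply, norm_sum_sq_of_inner_eq_zero _ _ fun i _ j _ hij =>
    inner_apply_apply_eq_zero (hq i) (horth i j hij) _ _, sum_inner, Complex.ofReal_sum]
  exact Finset.sum_congr rfl fun i _ => inner_apply_self_of_isStarProjection (hq i) ξ

end GenArens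

end

/-! ### The support and the formula for `δ` -/

open GenArens in
theorem lemma3p3 {H : Type*} [NormedAddCommGroup H] [InnerProductSpace ℂ H] [CompleteSpace H]
    (M : VonNeumannAlgebra H) (hM : ∀ a ∈ M, ∀ b ∈ M, a * b = b * a)
    (τ : FiniteTrace M) (Λ : Set (ℝ → ℝ)) (hΛ : IsQuadraticFamily Λ)
    (δ : arensAlgebra τ Λ → arensAlgebra τ Λ) (hδ : IsAdditiveDerivation δ) :
    ∃ z : Proj M, IsGLB (supportSet δ) z ∧ FiniteDimensional ℂ (cutDown z) ∧
      ∃ (k : ℕ) (q : Fin k → Proj M) (d : Fin k → Derivation ℤ ℂ ℂ),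
        (∀ i, (q i).IsMinimal) ∧ (∀ i j, i ≠ j → (q i).op * (q j).op = 0) ∧ (∀ i, d i ≠ 0) ∧
        z.op = ∑ i, (q i).op ∧
        ∀ x : arensAlgebra τ Λ, ∃ c : Fin k → ℂ,
          (∀ i, strongMul (ofCLM (q i).op) x.1 = ofCLM (c i • (q i).op)) ∧
          (δ x).1 = ofCLM (∑ i, d i (c i) • (q i).op) := by
  have hfin := finite_active_atoms hM hΛ hδ
  have : Finite {q : Proj M | q.IsMinimal ∧ IsActive δ q} := hfin
  let e := Finite.equivFin {q : Proj M | q.IsMinimal ∧ IsActive δ q}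
  let q : Fin (Nat.card {q : Proj M | q.IsMinimal ∧ IsActive δ q}) → Proj M :=
    fun i => (e.symm i).1
  have hmin : ∀ i, (q i).IsMinimal := fun i => (e.symm i).2.1
  have hact : ∀ i, IsActive δ (q i) := fun i => (e.symm i).2.2
  have horth : ∀ i j, i ≠ j → (q i).op * (q j).op = 0 := fun i j hij =>
    (hmin i).mul_eq_zero hM (hmin j) fun h => hij (e.symm.injective (Subtype.ext h))
  choose d hd using fun i => exists_derivation_of_atom hM hΛ hδ (hmin i)
  let z : Proj M := Proj.mk (∑ i, (q i).op) (sum_mem fun i _ => (q i).op_mem)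
    (isStarProjection_sum (fun i => (q i).isStarProjection_op) horth)
  have hz : z.op = ∑ i, (q i).op := rfl
  have hqz : ∀ i, (q i).op * z.op = (q i).op := by
    intro i
    rw [hz, Finset.mul_sum, Finset.sum_eq_single i]
    · exact (q i).op_op
    · exact fun j _ hj => horth i j hj.symm
    · exact fun h => absurd (Finset.mem_univ i) h
  let z' : Proj M := Proj.mk (1 - z.op) (sub_mem (one_mem M) z.op_mem)
    z.isStarProjection_op.one_sub
  -- Otherwise an active atom lies under `1 - z`; but every active atom is some `q i`, hence under
  -- `z`.
  have hnull : IsNull δ z' := by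
    by_contra h
    obtain ⟨r, hr, hrz⟩ := exists_isActive_of_not_isNull hM hΛ hδ h
    obtain ⟨p, hp, hpa, hpr⟩ := exists_isMinimal_of_isActive hM hΛ hδ hr
    obtain ⟨i, hi⟩ : ∃ i, q i = p := ⟨e ⟨p, hp, hpa⟩,
      congrArg Subtype.val (e.symm_apply_apply ⟨p, hp, hpa⟩)⟩
    have h1 : p.op * (1 - z.op) = p.op := by
      rw [← hpr, mul_assoc]
      exact congrArg _ hrz
    rw [mul_sub, mul_one, ← hi, hqz i, sub_self] at h1
    exact (hmin i).1 h1.symm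
  have hx : ∀ x : arensAlgebra τ Λ, ∃ c : Fin _ → ℂ,
      (∀ i, strongMul (ofCLM (q i).op) x.1 = ofCLM (c i • (q i).op)) ∧
      (δ x).1 = ofCLM (∑ i, d i (c i) • (q i).op) := by
    intro x
    choose c hc using fun i => exists_cut_of_isMinimal hM hΛ (hmin i) x.2
    refine ⟨c, fun i => ofCLM_strongMul_eq_of_cut hM hΛ x.2 (hc i), ?_⟩
    -- The scalar of `δ(x)` on `q i` is read off from `q i δ(x) = δ(q i x) = δ(c i q i)`.
    have hcut : ∀ i, Cut (δ x).1 (q i).op (d i (c i) • (q i).op) := by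
      intro i
      obtain ⟨m, hm⟩ := exists_cut_of_isMinimal hM hΛ (hmin i) (δ x).2
      have h1 := cut_bddDer_of_cut hM hΛ hδ x (hc i) (hc i) hm
      rw [hd, mul_smul_comm, (q i).op_op] at h1
      have h2 := h1.unique (cut_ofCLM _ _)
      rw [smul_mul_assoc, (q i).op_op] at h2
      rwa [← h2]
    obtain ⟨f, b, hb, hf⟩ := exists_cut_of_mem_arensAlgebra hΛ (δ x).2
    have h0 := ofCLM_mem_measurableOps τ (a := ∑ i, d i (c i) • (q i).op)
      (sum_mem fun i _ => M.toStarSubalgebra.smul_mem (q i).op_mem _)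
    refine eq_of_cut hM (δ x).2.1.1 h0.1 (δ x).2.1.2.1 h0.2.1 hf hb fun n => ?_
    have hbM := (hb n).mem (δ x).2.1.2.1
    have h1 : (1 - z.op) * b n = 0 := hnull x (f n) (b n) (hb n)
    -- As `1 - z` is null, `b n = z b n` splits into its components on the atoms.
    have h2 : b n = (∑ i, d i (c i) • (q i).op) * (f n).op := by
      rw [sub_mul, one_mul, sub_eq_zero] at h1
      rw [h1, hz, Finset.sum_mul, Finset.sum_mul]
      refine Finset.sum_congr rfl fun i _ => ?_
      have h3 := (hb n).mul (q i).op
      rw [hM _ (f n).op_mem _ (q i).op_mem] at h3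
      rw [hM _ (q i).op_mem _ hbM, h3.unique ((hcut i).mul (f n).op)]
    rw [h2]
    exact cut_ofCLM _ _
  refine ⟨z, ⟨fun w hw => ?_, fun w hw => hw fun x => ?_⟩, ?_, _, q, d, hmin, horth,
    fun i => derivation_ne_zero_of_isActive hM hΛ hδ (hmin i) (hact i) (hd i), hz, hx⟩
  · rw [Proj.le_iff, hz, Finset.sum_mul]
    exact Finset.sum_congr rfl fun i _ =>
      mul_op_eq_of_mem_supportSet hM hΛ (hmin i) (hact i) hw
  · obtain ⟨c, -, hc⟩ := hx x
    rw [hc, strongMul_ofCLM_ofCLM, Finset.mul_sum]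
    congr 1
    refine Finset.sum_congr rfl fun i _ => ?_
    rw [mul_smul_comm, hM _ z.op_mem _ (q i).op_mem, hqz i]
  · have := FiniteDimensional.span_of_finite ℂ (Set.finite_range fun i => (q i).op)
    refine Submodule.finiteDimensional_of_le
      (S₂ := Submodule.span ℂ (Set.range fun i => (q i).op)) ?_
    rintro _ ⟨a, ha, rfl⟩
    change z.op * a ∈ _
    rw [hz, Finset.sum_mul]
    refine Submodule.sum_mem _ fun i _ => ?_
    obtain ⟨c, hc⟩ := (hmin i).exists_smul hM ha
    rw [hM _ (q i).op_mem _ ha, hc]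
    exact Submodule.smul_mem _ _ (Submodule.subset_span (Set.mem_range_self i))
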